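/- Let $\Lambda$ be a finite dimensional hereditary algebra over a field $K$. All modules are right modules. Let $S_1,\dots,S_n$ be the simple $\Lambda$-modules, one from each isomorphism class, let $P_i\to S_i$ be a projective cover of $S_i$, and write $rX$ for the radical of a module $X$ and $r^2X=r(rX)$. Put $F_i=\operatorname{End}_\Lambda(P_i)$; this is a finite dimensional division algebra over $K$ and is identified with $\operatorname{End}_\Lambda(S_i)$ through $P_i\to S_i$. The associated modulated quiver $(Q,\mathcal M)$ has vertices $1,\dots,n$, an arrow $i\to j$ whenever $\operatorname{Ext}^1_\Lambda(S_i,S_j)\neq 0$, the division algebra $F_i$ at the vertex $i$, and on each arrow $i\to j$ the $F_i$-$F_j$-bimodule $M_{ij}=\operatorname{Hom}_\Lambda(P_j,rP_i/r^2P_i)$, on which $F_i$ and $F_j$ act by composition. Its tensor algebra $$T(Q,\mathcal M)=\bigoplus M_{j_0j_1}\otimes_{F_{j_1}}M_{j_1j_2}\otimes_{F_{j_2}}\cdots\otimes_{F_{j_{r-1}}}M_{j_{r-1}j_r}$$ is the direct sum over all paths $j_0\to j_1\to\cdots\to j_r$ in $Q$, including the paths of length zero (which contribute the $F_j$), with multiplication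 given by concatenation of paths. Then $\Lambda$ is Morita equivalent to $T(Q,\mathcal M)$ (that is, their categories of modules are equivalent as $K$-linear categories) if and only if, for each arrow $i\to j$ of $Q$, the epimorphism of $F_i$-$F_j$-bimodules $$\operatorname{Hom}_\Lambda(P_j,rP_i)\twoheadrightarrow M_{ij}=\operatorname{Hom}_\Lambda(P_j,rP_i/r^2P_i)$$ induced by the projection $rP_i\to rP_i/r^2P_i$ has a section that is a homomorphism of $F_i$-$F_j$-bimodules. -/

import Mathlib

open scoped TensorProduct
open CategoryTheory

universe u v w

/-! ## Tensor products over a noncommutative algebra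

Throughout, a right `F`-module is a module over `Fᵐᵒᵖ`; `MulOpposite.op f • x` is `x · f`. -/

section Balanced

variable (K : Type u) [Field K] (F : Type v) [Ring F]
variable (X : Type v) [AddCommGroup X] [Module K X] [Module Fᵐᵒᵖ X]
variable (Y : Type v) [AddCommGroup Y] [Module K Y] [Module F Y]

/-- The relations `x f ⊗ y = x ⊗ f y`. -/
def balancedRelations : Submodule K (X ⊗[K] Y) :=
  Submodule.span K {t | ∃ (x : X) (f : F) (y : Y),
    t = (MulOpposite.op f • x) ⊗ₜ[K] y - x ⊗ₜ[K] (f • y)}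

/-- The tensor product `X ⊗_F Y` of a right module `X` and a left module `Y` over a
`K`-algebra `F`. -/
def BalancedTensor : Type v := (X ⊗[K] Y) ⧸ balancedRelations K F X Y

namespace BalancedTensor

noncomputable instance : AddCommGroup (BalancedTensor K F X Y) :=
  inferInstanceAs (AddCommGroup ((X ⊗[K] Y) ⧸ balancedRelations K F X Y))

noncomputable instance : Module K (BalancedTensor K F X Y) :=
  inferInstanceAs (Module K ((X ⊗[K] Y) ⧸ balancedRelations K F X Y))

/-- The quotient map `X ⊗_K Y → X ⊗_F Y`. -/
noncomputable def proj : (X ⊗[K] Y) →ₗ[K] BalancedTensor K F X Y :=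
  (balancedRelations K F X Y).mkQ

variable {X Y}

/-- The pure tensor `x ⊗ y` in `X ⊗_F Y`. -/
noncomputable def tmul (x : X) (y : Y) : BalancedTensor K F X Y := proj K F X Y (x ⊗ₜ[K] y)

variable {K F}

theorem smul_tmul (x : X) (f : F) (y : Y) :
    tmul K F (MulOpposite.op f • x) y = tmul K F x (f • y) :=
  (Submodule.Quotient.eq _).2 (Submodule.subset_span ⟨x, f, y, rfl⟩)

theorem hom_ext {Z : Type w} [AddCommGroup Z] [Module K Z]
    {g h : BalancedTensor K F X Y →ₗ[K] Z}
    (H : ∀ x y, g (tmul K F x y) = h (tmul K F x y)) : g = h := by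
  apply Submodule.linearMap_qext
  exact TensorProduct.ext' H

/-- The linear map out of `X ⊗_F Y` given by an `F`-balanced bilinear map. -/
noncomputable def lift {Z : Type w} [AddCommGroup Z] [Module K Z] (b : X →ₗ[K] Y →ₗ[K] Z)
    (hb : ∀ (x : X) (f : F) (y : Y), b (MulOpposite.op f • x) y = b x (f • y)) :
    BalancedTensor K F X Y →ₗ[K] Z :=
  (balancedRelations K F X Y).liftQ (TensorProduct.lift b) (by
    rw [balancedRelations, Submodule.span_le]
    rintro _ ⟨x, f, y, rfl⟩
    simp [hb])

@[simp] theorem lift_tmul {Z : Type w} [AddCommGroup Z] [Module K Z] (b : X →ₗ[K] Y →ₗ[K] Z)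
    (hb : ∀ (x : X) (f : F) (y : Y), b (MulOpposite.op f • x) y = b x (f • y)) (x : X) (y : Y) :
    lift b hb (tmul K F x y) = b x y := by
  change TensorProduct.lift b (x ⊗ₜ[K] y) = b x y
  simp

theorem add_tmul (x x' : X) (y : Y) :
    tmul K F (x + x') y = tmul K F x y + tmul K F x' y := by
  simp [tmul, TensorProduct.add_tmul]

theorem tmul_add (x : X) (y y' : Y) :
    tmul K F x (y + y') = tmul K F x y + tmul K F x y' := by
  simp [tmul, TensorProduct.tmul_add]

theorem smul_tmul_left (k : K) (x : X) (y : Y) : tmul K F (k • x) y = k • tmul K F x y := by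
  rw [tmul, ← TensorProduct.smul_tmul', map_smul]; rfl

theorem smul_tmul_right (k : K) (x : X) (y : Y) : tmul K F x (k • y) = k • tmul K F x y := by
  simp [tmul]

variable (K F X Y) in
/-- The universal balanced bilinear map `(x, y) ↦ x ⊗ y`. -/
noncomputable def mk : X →ₗ[K] Y →ₗ[K] BalancedTensor K F X Y :=
  LinearMap.mk₂ K (tmul K F) add_tmul smul_tmul_left tmul_add smul_tmul_right

@[simp] theorem mk_apply (x : X) (y : Y) : mk K F X Y x y = tmul K F x y := rfl

section Right

variable {G : Type v} [Ring G] [Algebra K G] [Module Gᵐᵒᵖ Y] [IsScalarTower K Gᵐᵒᵖ Y]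
  [SMulCommClass F Gᵐᵒᵖ Y]

/-- Right multiplication `x ⊗ y ↦ x ⊗ y g`. -/
noncomputable def rightMul (g : Gᵐᵒᵖ) : BalancedTensor K F X Y →ₗ[K] BalancedTensor K F X Y :=
  lift ((mk K F X Y).compl₂ (Module.toModuleEnd K (S := Gᵐᵒᵖ) Y g)) (fun x f y => by
    simp [smul_tmul, smul_comm f g y])

@[simp] theorem rightMul_tmul (g : Gᵐᵒᵖ) (x : X) (y : Y) :
    rightMul (K := K) (F := F) g (tmul K F x y) = tmul K F x (g • y) := by
  simp [rightMul]

/-- If `Y` is an `F`-`G`-bimodule, then `X ⊗_F Y` is a right `G`-module. -/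
noncomputable instance : Module Gᵐᵒᵖ (BalancedTensor K F X Y) where
  smul g t := rightMul g t
  one_smul t := by
    change rightMul (1 : Gᵐᵒᵖ) t = LinearMap.id (R := K) t
    exact LinearMap.congr_fun (hom_ext (fun x y => by simp)) t
  mul_smul g h t := by
    change rightMul (g * h) t = ((rightMul g).comp (rightMul h)) t
    exact LinearMap.congr_fun (hom_ext (fun x y => by simp [mul_smul])) t
  smul_zero g := map_zero (rightMul g)
  smul_add g := map_add (rightMul g)
  add_smul g h t := by
    change rightMul (K := K) (g + h) t = (rightMul (K := K) g + rightMul h : _ →ₗ[K] _) t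
    exact LinearMap.congr_fun (hom_ext (fun x y => by simp [add_smul, tmul_add])) t
  zero_smul t := by
    change rightMul (0 : Gᵐᵒᵖ) t = (0 : BalancedTensor K F X Y →ₗ[K] _) t
    exact LinearMap.congr_fun (hom_ext (fun x y => by rw [rightMul_tmul, zero_smul]; simp [tmul])) t

theorem right_smul_tmul (g : Gᵐᵒᵖ) (x : X) (y : Y) :
    g • tmul K F x y = tmul K F x (g • y) := rightMul_tmul g x y

instance : IsScalarTower K Gᵐᵒᵖ (BalancedTensor K F X Y) where
  smul_assoc k g t := by
    change rightMul (k • g) t = (k • rightMul g) t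
    exact LinearMap.congr_fun (hom_ext (fun x y => by simp [smul_tmul_right])) t

theorem extendRight_balanced {Z N : Type v} [AddCommGroup Z]
    [Module K Z] [Module Fᵐᵒᵖ Z] [AddCommGroup N] [Module K N] [Module F N]
    (c : X →ₗ[K] Z) (hc : ∀ x (g : Fᵐᵒᵖ), c (g • x) = g • c x) (x : X) (f : F) (m : N) :
    (mk K F Z N).comp c (MulOpposite.op f • x) m = (mk K F Z N).comp c x (f • m) := by
  rw [LinearMap.comp_apply, LinearMap.comp_apply, mk_apply, mk_apply, hc, smul_tmul]

/-- Given `c : W → X → Z` bilinear, and right `F`-linear in the second variable, the map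
`(w, x ⊗ m) ↦ c w x ⊗ m`. -/
noncomputable def extendRight {W Z N : Type v} [AddCommGroup W] [Module K W] [AddCommGroup Z]
    [Module K Z] [Module Fᵐᵒᵖ Z] [AddCommGroup N] [Module K N] [Module F N]
    (c : W →ₗ[K] X →ₗ[K] Z) (hc : ∀ w x (g : Fᵐᵒᵖ), c w (g • x) = g • c w x) :
    W →ₗ[K] BalancedTensor K F X N →ₗ[K] BalancedTensor K F Z N where
  toFun w := lift ((mk K F Z N).comp (c w)) (extendRight_balanced (c w) (hc w))
  map_add' w w' := hom_ext (fun x m => by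
    rw [LinearMap.add_apply, lift_tmul, lift_tmul, lift_tmul]; simp)
  map_smul' k w := hom_ext (fun x m => by
    rw [LinearMap.smul_apply, lift_tmul, lift_tmul]; simp)

@[simp] theorem extendRight_tmul {W Z N : Type v} [AddCommGroup W] [Module K W] [AddCommGroup Z]
    [Module K Z] [Module Fᵐᵒᵖ Z] [AddCommGroup N] [Module K N] [Module F N]
    (c : W →ₗ[K] X →ₗ[K] Z) (hc : ∀ w x (g : Fᵐᵒᵖ), c w (g • x) = g • c w x)
    (w : W) (x : X) (m : N) :
    extendRight c hc w (tmul K F x m) = tmul K F (c w x) m :=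
  lift_tmul ((mk K F Z N).comp (c w)) (extendRight_balanced (c w) (hc w)) x m

theorem extendRight_smul {W Z : Type v} [AddCommGroup W] [Module K W] [AddCommGroup Z]
    [Module K Z] [Module Fᵐᵒᵖ Z]
    (c : W →ₗ[K] X →ₗ[K] Z) (hc : ∀ w x (g : Fᵐᵒᵖ), c w (g • x) = g • c w x)
    (w : W) (t : BalancedTensor K F X Y) (g : Gᵐᵒᵖ) :
    extendRight c hc w (g • t) = g • extendRight c hc w t := by
  have h : (extendRight c hc w).comp (rightMul g) =
      (rightMul g).comp (extendRight (N := Y) c hc w) :=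
    hom_ext (fun y m => by simp)
  exact LinearMap.congr_fun h t

end Right

end BalancedTensor

end Balanced

/-! ## Modulated quivers and their tensor algebras -/

/-- A modulated quiver over a field `K`: a finite quiver without oriented cycles and without
multiple arrows, a finite dimensional division algebra `F i` over `K` at each vertex, and a finite
dimensional `F i`-`F j`-bimodule `M i j` (on which `K` acts centrally) for each arrow `i → j`. -/
structure ModulatedQuiver (K : Type u) [Field K] where
  V : Type w
  [fintypeV : Fintype V]
  Arrow : V → V → Prop
  acyclic : ∀ i, ¬ Relation.TransGen Arrow i i
  F : V → Type v
  [divisionRingF : ∀ i, DivisionRing (F i)]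
  [algebraF : ∀ i, Algebra K (F i)]
  [finiteF : ∀ i, Module.Finite K (F i)]
  M : ∀ i j, Arrow i j → Type v
  [addCommGroupM : ∀ i j a, AddCommGroup (M i j a)]
  [moduleM : ∀ i j a, Module K (M i j a)]
  [leftModuleM : ∀ i j a, Module (F i) (M i j a)]
  [rightModuleM : ∀ i j a, Module (F j)ᵐᵒᵖ (M i j a)]
  [bimoduleM : ∀ i j a, SMulCommClass (F i) (F j)ᵐᵒᵖ (M i j a)]
  [leftTowerM : ∀ i j a, IsScalarTower K (F i) (M i j a)]
  [rightTowerM : ∀ i j a, IsScalarTower K (F j)ᵐᵒᵖ (M i j a)]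
  [finiteM : ∀ i j a, Module.Finite K (M i j a)]

namespace ModulatedQuiver

attribute [instance] fintypeV divisionRingF algebraF finiteF addCommGroupM moduleM leftModuleM
  rightModuleM bimoduleM leftTowerM rightTowerM finiteM

variable {K : Type u} [Field K]

/-- A right module over a `K`-algebra `F`, bundled together with its `K`-module structure. -/
structure RightModule (K : Type u) [Field K] (F : Type v) [Ring F] [Algebra K F] where
  carrier : Type v
  [addCommGroup : AddCommGroup carrier]
  [moduleK : Module K carrier]
  [moduleF : Module Fᵐᵒᵖ carrier]
  [tower : IsScalarTower K Fᵐᵒᵖ carrier]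

attribute [instance] RightModule.addCommGroup RightModule.moduleK RightModule.moduleF
  RightModule.tower

variable (Q : ModulatedQuiver.{u, v, w} K)

/-- The vertices of `Q` as a quiver. -/
instance quiverV : Quiver.{0} Q.V := ⟨fun i j => PLift (Q.Arrow i j)⟩

/-- The bimodule on an arrow. -/
abbrev bimodule {i j : Q.V} (a : i ⟶ j) : Type v := Q.M i j a.down

/-- The tensor path `M_{j₀ j₁} ⊗ M_{j₁ j₂} ⊗ ⋯ ⊗ M_{j_{r-1} j_r}` (tensor products over the
`F_j` at the inner vertices) of a path `j₀ → j₁ → ⋯ → j_r`, as a right module over `F_{j_r}`. It is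
`F_j` on the path of length zero at `j`, and `F_{j₀} ⊗_{F_{j₀}} M_{j₀ j₁} ⊗ ⋯` otherwise. -/
noncomputable def pathModule {i : Q.V} : ∀ {j : Q.V}, Quiver.Path i j → RightModule K (Q.F j)
  | _, .nil => { carrier := Q.F i }
  | _, .cons (b := b) p a =>
      { carrier := BalancedTensor K (Q.F b) (pathModule p).carrier (Q.bimodule a) }

/-- The underlying space of `pathModule`. -/
abbrev TensorPath {i j : Q.V} (p : Quiver.Path i j) : Type v := (Q.pathModule p).carrier

/-- The space attached to the path of length zero at `i` is `F i`. -/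
noncomputable def nilEquiv (i : Q.V) : Q.F i ≃ₗ[K] Q.TensorPath (.nil : Quiver.Path i i) :=
  LinearEquiv.refl K (Q.F i)

theorem smul_nilEquiv (i : Q.V) (f : Q.F i) (g : (Q.F i)ᵐᵒᵖ) :
    g • Q.nilEquiv i f = Q.nilEquiv i (f * g.unop) := rfl

/-- The space attached to a path that ends in the arrow `a`. -/
noncomputable def consEquiv {i j k : Q.V} (p : Quiver.Path i j) (a : j ⟶ k) :
    BalancedTensor K (Q.F j) (Q.TensorPath p) (Q.bimodule a) ≃ₗ[K] Q.TensorPath (p.cons a) :=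
  LinearEquiv.refl K (BalancedTensor K (Q.F j) (Q.TensorPath p) (Q.bimodule a))

theorem smul_consEquiv {i j k : Q.V} (p : Quiver.Path i j) (a : j ⟶ k)
    (t : BalancedTensor K (Q.F j) (Q.TensorPath p) (Q.bimodule a)) (g : (Q.F k)ᵐᵒᵖ) :
    g • Q.consEquiv p a t = Q.consEquiv p a (g • t) := rfl

/-- The pure tensor `t ⊗ m` attached to a path that ends in the arrow `a`. -/
noncomputable def snoc {i j k : Q.V} {p : Quiver.Path i j} (t : Q.TensorPath p) (a : j ⟶ k)
    (m : Q.bimodule a) : Q.TensorPath (p.cons a) :=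
  Q.consEquiv p a (BalancedTensor.tmul K (Q.F j) t m)

/-- The right action of `F j` on a tensor path that ends at `j`, as a bilinear map. -/
noncomputable def rightAct {i j : Q.V} (p : Quiver.Path i j) :
    Q.TensorPath p →ₗ[K] Q.F j →ₗ[K] Q.TensorPath p :=
  LinearMap.mk₂ K (fun (x : Q.TensorPath p) (f : Q.F j) => MulOpposite.op f • x)
    (fun x x' f => smul_add _ x x')
    (fun k x f => (smul_comm k (MulOpposite.op f) x).symm)
    (fun x f f' => by rw [MulOpposite.op_add, add_smul])
    (fun k x f => by rw [MulOpposite.op_smul, smul_assoc])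

/-- Concatenation of tensor paths `(x, y) ↦ x ⊗ y`, together with its compatibility with the
right action of the division algebra at the end vertex. For a second path of length zero it is the
right action of `F_j`, and `x ⊗ (t ⊗ m) = (x ⊗ t) ⊗ m`. -/
noncomputable def concatAux {i j : Q.V} (p : Quiver.Path i j) : ∀ {k : Q.V} (q : Quiver.Path j k),
    { c : Q.TensorPath p →ₗ[K] Q.TensorPath q →ₗ[K] Q.TensorPath (p.comp q) //
      ∀ x y (g : (Q.F k)ᵐᵒᵖ), c x (g • y) = g • c x y }
  | _, .nil => ⟨(Q.rightAct p).compl₂ (Q.nilEquiv j).symm.toLinearMap, fun x y g => by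
      obtain ⟨f, rfl⟩ := (Q.nilEquiv j).surjective y
      change Q.rightAct p x (f * g.unop) = g • Q.rightAct p x f
      simp only [rightAct, LinearMap.mk₂_apply]
      rw [MulOpposite.op_mul, mul_smul, MulOpposite.op_unop]⟩
  | _, .cons q a =>
      ⟨((BalancedTensor.extendRight (concatAux p q).1 (concatAux p q).2).compl₂
          (Q.consEquiv q a).symm.toLinearMap).compr₂ (Q.consEquiv (p.comp q) a).toLinearMap,
        fun x y g => BalancedTensor.extendRight_smul (concatAux p q).1 (concatAux p q).2 x
          ((Q.consEquiv q a).symm y) g⟩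

/-- Concatenation of tensor paths. -/
noncomputable def concat {i j k : Q.V} (p : Quiver.Path i j) (q : Quiver.Path j k) :
    Q.TensorPath p →ₗ[K] Q.TensorPath q →ₗ[K] Q.TensorPath (p.comp q) :=
  (Q.concatAux p q).1

theorem concat_smul {i j k : Q.V} (p : Quiver.Path i j) (q : Quiver.Path j k)
    (x : Q.TensorPath p) (y : Q.TensorPath q) (g : (Q.F k)ᵐᵒᵖ) :
    Q.concat p q x (g • y) = g • Q.concat p q x y := (Q.concatAux p q).2 x y g

theorem concat_nil {i j : Q.V} (p : Quiver.Path i j) (x : Q.TensorPath p) (f : Q.F j) :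
    Q.concat p .nil x (Q.nilEquiv j f) = MulOpposite.op f • x := rfl

theorem concat_snoc {i j k l : Q.V} (p : Quiver.Path i j) (q : Quiver.Path j k) (a : k ⟶ l)
    (x : Q.TensorPath p) (t : Q.TensorPath q) (m : Q.bimodule a) :
    Q.concat p (q.cons a) x (Q.snoc t a m) = Q.snoc (Q.concat p q x t) a m :=
  congrArg (Q.consEquiv (p.comp q) a)
    (BalancedTensor.extendRight_tmul (Q.concatAux p q).1 (Q.concatAux p q).2 x t m)

open Classical in
/-- The direct sum of all tensor paths from `i` to `j`. -/
abbrev PathSum (i j : Q.V) : Type (max v w) :=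
  DirectSum (Quiver.Path i j) (fun p => Q.TensorPath p)

open Classical in
/-- The inclusion of a tensor path in the direct sum. -/
noncomputable def incl {i j : Q.V} (p : Quiver.Path i j) : Q.TensorPath p →ₗ[K] Q.PathSum i j :=
  DirectSum.lof K _ _ p

open Classical in
theorem pathSum_hom_ext {i j : Q.V} {Z : Type*} [AddCommGroup Z] [Module K Z]
    {g h : Q.PathSum i j →ₗ[K] Z} (H : ∀ p x, g (Q.incl p x) = h (Q.incl p x)) : g = h :=
  DirectSum.linearMap_ext K (fun p => LinearMap.ext (H p))

open Classical in
/-- Concatenation on the direct sums of tensor paths. -/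
noncomputable def comp (i j k : Q.V) :
    Q.PathSum i j →ₗ[K] Q.PathSum j k →ₗ[K] Q.PathSum i k :=
  DirectSum.toModule K _ _ (fun p => LinearMap.flip (DirectSum.toModule K _ _ (fun q =>
    LinearMap.flip ((Q.concat p q).compr₂ (Q.incl (p.comp q))))))

theorem comp_incl {i j k : Q.V} (p : Quiver.Path i j) (q : Quiver.Path j k)
    (x : Q.TensorPath p) (y : Q.TensorPath q) :
    Q.comp i j k (Q.incl p x) (Q.incl q y) = Q.incl (p.comp q) (Q.concat p q x y) := by
  simp [comp, incl]

/-- The element `1 ∈ F_i` on the path of length zero. -/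
noncomputable def idPath (i : Q.V) : Q.PathSum i i := Q.incl .nil (Q.nilEquiv i 1)

open Classical in
/-- Right concatenation with an element of an arrow bimodule. -/
noncomputable def extend {i j k : Q.V} (a : j ⟶ k) (m : Q.bimodule a) :
    Q.PathSum i j →ₗ[K] Q.PathSum i k :=
  DirectSum.toModule K _ _ (fun p => (Q.incl (p.cons a)).comp ((Q.consEquiv p a).toLinearMap.comp
    ((BalancedTensor.mk K (Q.F j) (Q.TensorPath p) (Q.bimodule a)).flip m)))

theorem extend_incl {i j k : Q.V} (a : j ⟶ k) (m : Q.bimodule a) (p : Quiver.Path i j)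
    (t : Q.TensorPath p) : Q.extend a m (Q.incl p t) = Q.incl (p.cons a) (Q.snoc t a m) := by
  simp only [extend, incl, DirectSum.toModule_lof]
  rfl

theorem tensorPath_cons_ext {i j k : Q.V} {p : Quiver.Path i j} {a : j ⟶ k} {Z : Type*}
    [AddCommGroup Z] [Module K Z] {g h : Q.TensorPath (p.cons a) →ₗ[K] Z}
    (H : ∀ t m, g (Q.snoc t a m) = h (Q.snoc t a m)) : g = h :=
  BalancedTensor.hom_ext (F := Q.F j) (X := Q.TensorPath p) (Y := Q.bimodule a) H

theorem comp_id {i j : Q.V} (x : Q.PathSum i j) : Q.comp i j j x (Q.idPath j) = x := by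
  have : (Q.comp i j j).flip (Q.idPath j) = LinearMap.id :=
    Q.pathSum_hom_ext (fun p x => by
      rw [LinearMap.flip_apply, idPath, comp_incl, concat_nil, MulOpposite.op_one, one_smul]; rfl)
  exact LinearMap.congr_fun this x

theorem id_concat {i j : Q.V} (p : Quiver.Path i j) (x : Q.TensorPath p) :
    Q.incl (Quiver.Path.nil.comp p) (Q.concat .nil p (Q.nilEquiv i 1) x) = Q.incl p x := by
  induction p with
  | nil =>
    obtain ⟨f, rfl⟩ := (Q.nilEquiv i).surjective x
    rw [concat_nil, smul_nilEquiv, MulOpposite.unop_op, one_mul]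
    rfl
  | cons p a ih =>
    refine LinearMap.congr_fun (Q.tensorPath_cons_ext (g := (Q.incl (Quiver.Path.nil.comp
      (p.cons a))).comp (Q.concat .nil (p.cons a) (Q.nilEquiv i 1))) (fun t m => ?_)) x
    rw [LinearMap.comp_apply, concat_snoc]
    refine (Q.extend_incl a m _ _).symm.trans ?_
    rw [ih, extend_incl]

theorem id_comp {i j : Q.V} (x : Q.PathSum i j) : Q.comp i i j (Q.idPath i) x = x := by
  have : Q.comp i i j (Q.idPath i) = LinearMap.id :=
    Q.pathSum_hom_ext (fun p x => by rw [idPath, comp_incl, id_concat]; rfl)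
  exact LinearMap.congr_fun this x

theorem concat_assoc {i j k l : Q.V} (p : Quiver.Path i j) (q : Quiver.Path j k)
    (r : Quiver.Path k l) (x : Q.TensorPath p) (y : Q.TensorPath q) (z : Q.TensorPath r) :
    Q.incl ((p.comp q).comp r) (Q.concat (p.comp q) r (Q.concat p q x y) z) =
      Q.incl (p.comp (q.comp r)) (Q.concat p (q.comp r) x (Q.concat q r y z)) := by
  induction r with
  | nil =>
    obtain ⟨f, rfl⟩ := (Q.nilEquiv k).surjective z
    rw [concat_nil, concat_nil]
    exact congrArg (Q.incl (p.comp q)) (Q.concat_smul p q x y (MulOpposite.op f)).symm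
  | cons r a ih =>
    refine LinearMap.congr_fun (Q.tensorPath_cons_ext
      (g := (Q.incl ((p.comp q).comp (r.cons a))).comp
        (Q.concat (p.comp q) (r.cons a) (Q.concat p q x y)))
      (h := (Q.incl (p.comp (q.comp (r.cons a)))).comp
        ((Q.concat p (q.comp (r.cons a)) x).comp (Q.concat q (r.cons a) y)))
      (fun t m => ?_)) z
    simp only [LinearMap.comp_apply]
    rw [concat_snoc, concat_snoc]
    refine (Q.extend_incl a m _ _).symm.trans ?_
    rw [ih, extend_incl]
    exact congrArg (Q.incl ((p.comp (q.comp r)).cons a))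
      (Q.concat_snoc p (q.comp r) a x (Q.concat q r y t) m).symm

theorem comp_assoc {i j k l : Q.V} (x : Q.PathSum i j) (y : Q.PathSum j k) (z : Q.PathSum k l) :
    Q.comp i k l (Q.comp i j k x y) z = Q.comp i j l x (Q.comp j k l y z) := by
  have h1 : ∀ (p : Quiver.Path i j) (x : Q.TensorPath p) (q : Quiver.Path j k)
      (y : Q.TensorPath q), Q.comp i k l (Q.comp i j k (Q.incl p x) (Q.incl q y)) z =
        Q.comp i j l (Q.incl p x) (Q.comp j k l (Q.incl q y) z) := fun p x q y => by
    have : Q.comp i k l (Q.comp i j k (Q.incl p x) (Q.incl q y)) =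
        (Q.comp i j l (Q.incl p x)).comp (Q.comp j k l (Q.incl q y)) :=
      Q.pathSum_hom_ext (fun r z => by
        simp only [LinearMap.comp_apply, comp_incl, concat_assoc])
    exact LinearMap.congr_fun this z
  have h2 : ∀ (p : Quiver.Path i j) (x : Q.TensorPath p),
      Q.comp i k l (Q.comp i j k (Q.incl p x) y) z =
        Q.comp i j l (Q.incl p x) (Q.comp j k l y z) := fun p x => by
    have : ((Q.comp i k l).flip z).comp (Q.comp i j k (Q.incl p x)) =
        (Q.comp i j l (Q.incl p x)).comp ((Q.comp j k l).flip z) :=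
      Q.pathSum_hom_ext (fun q y => h1 p x q y)
    exact LinearMap.congr_fun this y
  have : ((Q.comp i k l).flip z).comp ((Q.comp i j k).flip y) =
      (Q.comp i j l).flip (Q.comp j k l y z) :=
    Q.pathSum_hom_ext (fun p x => h2 p x)
  exact LinearMap.congr_fun this x

/-- The tensor algebra of a modulated quiver: the direct sum of all tensor paths, including those
of length zero. An element is recorded as the family of its components in the direct sums of the
tensor paths from `i` to `j`, for the (finitely many) pairs of vertices `i, j`. -/
def TensorAlgebra : Type (max v w) := ∀ i j : Q.V, Q.PathSum i j

namespace TensorAlgebra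

noncomputable instance : AddCommGroup Q.TensorAlgebra :=
  inferInstanceAs (AddCommGroup (∀ i j : Q.V, Q.PathSum i j))

noncomputable instance : Module K Q.TensorAlgebra :=
  inferInstanceAs (Module K (∀ i j : Q.V, Q.PathSum i j))

/-- The multiplication is the concatenation of paths. -/
noncomputable instance : Mul Q.TensorAlgebra :=
  ⟨fun x y i k => ∑ j : Q.V, Q.comp i j k (x i j) (y j k)⟩

open Classical in
noncomputable instance : One Q.TensorAlgebra :=
  ⟨fun i j => if h : i = j then h ▸ Q.idPath i else 0⟩

variable {Q}

@[ext] theorem ext {x y : Q.TensorAlgebra} (h : ∀ i j, x i j = y i j) : x = y :=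
  funext fun i => funext fun j => h i j

theorem mul_apply (x y : Q.TensorAlgebra) (i k : Q.V) :
    (x * y) i k = ∑ j : Q.V, Q.comp i j k (x i j) (y j k) := rfl

theorem add_apply (x y : Q.TensorAlgebra) (i k : Q.V) : (x + y) i k = x i k + y i k := rfl

theorem smul_apply (c : K) (x : Q.TensorAlgebra) (i k : Q.V) : (c • x) i k = c • x i k := rfl

theorem zero_apply (i k : Q.V) : (0 : Q.TensorAlgebra) i k = 0 := rfl

theorem one_apply_same (i : Q.V) : (1 : Q.TensorAlgebra) i i = Q.idPath i := by
  classical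
  exact dif_pos rfl

theorem one_apply_ne {i j : Q.V} (h : i ≠ j) : (1 : Q.TensorAlgebra) i j = 0 := by
  classical
  exact dif_neg h

noncomputable instance : Ring Q.TensorAlgebra where
  __ := (inferInstance : AddCommGroup Q.TensorAlgebra)
  mul := (· * ·)
  one := 1
  left_distrib x y z := by
    ext i k
    simp [mul_apply, add_apply, Finset.sum_add_distrib]
  right_distrib x y z := by
    ext i k
    simp [mul_apply, add_apply, Finset.sum_add_distrib]
  zero_mul x := by
    ext i k
    simp [mul_apply, zero_apply]
  mul_zero x := by
    ext i k
    simp [mul_apply, zero_apply]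
  mul_assoc x y z := by
    ext i l
    simp only [mul_apply, map_sum, LinearMap.sum_apply, comp_assoc]
    rw [Finset.sum_comm]
  one_mul x := by
    ext i k
    rw [mul_apply, Finset.sum_eq_single i (fun j _ hj => by rw [one_apply_ne hj.symm]; simp)
      (fun h => absurd (Finset.mem_univ i) h), one_apply_same, id_comp]
  mul_one x := by
    ext i k
    rw [mul_apply, Finset.sum_eq_single k (fun j _ hj => by rw [one_apply_ne hj]; simp)
      (fun h => absurd (Finset.mem_univ k) h), one_apply_same, comp_id]

noncomputable instance : Algebra K Q.TensorAlgebra :=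
  Algebra.ofModule
    (fun c x y => by ext i k; simp [mul_apply, smul_apply, Finset.smul_sum])
    (fun c x y => by ext i k; simp [mul_apply, smul_apply, Finset.smul_sum])

end TensorAlgebra

end ModulatedQuiver

/-! ## Projective covers and hereditary algebras -/

section Rings

variable {R : Type v} [Ring R]

/-- A ring is right hereditary if all its right ideals (that is, the left ideals of the opposite
ring) are projective right modules. For finite dimensional algebras this is the same as being left
hereditary. -/
def IsRightHereditary (A : Type v) [Ring A] : Prop :=
  ∀ I : Ideal Aᵐᵒᵖ, Module.Projective Aᵐᵒᵖ I

/-- `π : P → S` is a projective cover: `P` is projective, `π` is surjective, and the kernel of `π`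
is superfluous. -/
structure IsProjectiveCover {P S : Type*} [AddCommGroup P] [Module R P] [AddCommGroup S]
    [Module R S] (π : P →ₗ[R] S) : Prop where
  projective : Module.Projective R P
  surjective : Function.Surjective π
  superfluous : ∀ N : Submodule R P, N ⊔ LinearMap.ker π = ⊤ → N = ⊤

namespace IsProjectiveCover

variable {P S : Type*} [AddCommGroup P] [Module R P] [AddCommGroup S] [Module R S]
  [IsSimpleModule R S] {π : P →ₗ[R] S}

theorem eq_top_of_not_le (h : IsProjectiveCover π) {N : Submodule R P}
    (hN : ¬ N ≤ LinearMap.ker π) : N = ⊤ := by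
  apply h.superfluous
  have h1 : N.map π = ⊤ := (eq_bot_or_eq_top (N.map π)).resolve_left (fun h0 =>
    hN (LinearMap.le_ker_iff_map.2 h0))
  rw [← Submodule.comap_map_eq, h1, Submodule.comap_top]

theorem exists_surjective (h : IsProjectiveCover π) : ∃ g : R →ₗ[R] P, Function.Surjective g := by
  have := IsSimpleModule.nontrivial R S
  obtain ⟨s, hs⟩ := exists_ne (0 : S)
  obtain ⟨g, hg⟩ := Module.projective_lifting_property π (LinearMap.toSpanSingleton R S s)
    h.surjective
  refine ⟨g, LinearMap.range_eq_top.1 (h.eq_top_of_not_le fun hle => hs ?_)⟩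
  have h1 : π (g 1) = s := by rw [← LinearMap.comp_apply, hg]; simp
  rw [← h1]
  exact hle ⟨1, rfl⟩

/-- A submodule of the projective cover of a simple module over a ring whose left ideals are
projective is projective. -/
theorem projective_submodule (h : IsProjectiveCover π)
    (hR : ∀ I : Ideal R, Module.Projective R I) (N : Submodule R P) : Module.Projective R N := by
  have := h.projective
  obtain ⟨g, hg⟩ := h.exists_surjective
  obtain ⟨i, hi⟩ := Module.projective_lifting_property g LinearMap.id hg
  have hinj : Function.Injective i := fun x y hxy => by
    have := congrArg g hxy
    rwa [← LinearMap.comp_apply, ← LinearMap.comp_apply, hi] at this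
  have := hR (N.map i)
  exact Module.Projective.of_equiv (Submodule.equivMapOfInjective i hinj N).symm

theorem injective_of_ne_zero (h : IsProjectiveCover π)
    {P' S' : Type*} [AddCommGroup P'] [Module R P'] [AddCommGroup S'] [Module R S']
    [IsSimpleModule R S'] {π' : P' →ₗ[R] S'} (h' : IsProjectiveCover π')
    (hR : ∀ I : Ideal R, Module.Projective R I) (f : P →ₗ[R] P') (hf : f ≠ 0) :
    Function.Injective f := by
  have := h'.projective_submodule hR (LinearMap.range f)
  obtain ⟨s, hs⟩ := Module.projective_lifting_property f.rangeRestrict LinearMap.id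
    f.surjective_rangeRestrict
  have hs' : ∀ y, f.rangeRestrict (s y) = y := fun y => LinearMap.congr_fun hs y
  have hker : ¬ LinearMap.range s ≤ LinearMap.ker π := by
    intro hle
    apply hf
    rw [← LinearMap.ker_eq_top]
    apply h.superfluous
    rw [eq_top_iff]
    rintro x -
    have : x = (x - s (f.rangeRestrict x)) + s (f.rangeRestrict x) := by abel
    rw [this]
    refine Submodule.add_mem_sup ?_ (hle ⟨_, rfl⟩)
    have h2 : f.rangeRestrict (x - s (f.rangeRestrict x)) = 0 := by rw [map_sub, hs', sub_self]
    simpa using congrArg Subtype.val h2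
  have hsurj : Function.Surjective s := LinearMap.range_eq_top.1 (h.eq_top_of_not_le hker)
  intro x y hxy
  obtain ⟨x, rfl⟩ := hsurj x
  obtain ⟨y, rfl⟩ := hsurj y
  have : f.rangeRestrict (s x) = f.rangeRestrict (s y) := Subtype.ext hxy
  rw [hs', hs'] at this
  rw [this]

theorem finite (K : Type u) [Field K] [Algebra K R] [Module.Finite K R] [Module K P]
    [IsScalarTower K R P] (h : IsProjectiveCover π) : Module.Finite K P := by
  obtain ⟨g, hg⟩ := h.exists_surjective
  exact Module.Finite.of_surjective (g.restrictScalars K) hg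

theorem isUnit_or_eq_zero (K : Type u) [Field K] [Algebra K R] [Module.Finite K R] [Module K P]
    [IsScalarTower K R P] (h : IsProjectiveCover π)
    (hR : ∀ I : Ideal R, Module.Projective R I) (f : Module.End R P) : IsUnit f ∨ f = 0 := by
  by_cases hf : f = 0
  · exact Or.inr hf
  refine Or.inl ((Module.End.isUnit_iff f).2 ?_)
  have := h.finite K
  have hi := h.injective_of_ne_zero h hR f hf
  exact ⟨hi, (LinearMap.injective_iff_surjective (f := f.restrictScalars K)).1 hi⟩

theorem nontrivial (h : IsProjectiveCover π) : Nontrivial P :=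
  have := IsSimpleModule.nontrivial R S
  h.surjective.nontrivial

theorem ker_le_ker_comp (h : IsProjectiveCover π) (f : Module.End R P) :
    LinearMap.ker π ≤ LinearMap.ker (π.comp f) := by
  by_cases hle : LinearMap.ker (π.comp f) ≤ LinearMap.ker π
  · by_cases h0 : π.comp f = 0
    · rw [h0, LinearMap.ker_zero]; exact le_top
    · have hc : IsCoatom (LinearMap.ker (π.comp f)) := LinearMap.isCoatom_ker_of_surjective
        (LinearMap.surjective_of_ne_zero h0)
      refine ((hc.le_iff.1 hle).resolve_left fun ht => ?_).le
      have := IsSimpleModule.nontrivial R S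
      obtain ⟨s, hs⟩ := exists_ne (0 : S)
      obtain ⟨x, rfl⟩ := h.surjective s
      exact hs (LinearMap.mem_ker.1 (ht ▸ Submodule.mem_top))
  · rw [h.eq_top_of_not_le hle]; exact le_top

/-- The endomorphism rings of a simple module `S` and of its projective cover `π : P → S` are
identified, through `π ∘ f = e f ∘ π`. -/
theorem exists_endEquiv (K : Type u) [Field K] [Algebra K R] [Module.Finite K R] [Module K P]
    [IsScalarTower K R P] (h : IsProjectiveCover π) (hR : ∀ I : Ideal R, Module.Projective R I) :
    ∃ e : Module.End R P ≃+* Module.End R S, ∀ f x, π (f x) = e f (π x) := by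
  have hex : ∀ f : Module.End R P, ∃ g : Module.End R S, ∀ x, π (f x) = g (π x) := fun f => by
    choose s hs using h.surjective
    have key : ∀ x y, π x = π y → π (f x) = π (f y) := fun x y hxy => by
      have : x - y ∈ LinearMap.ker (π.comp f) := h.ker_le_ker_comp f (by simp [hxy])
      simpa [sub_eq_zero] using this
    refine ⟨{ toFun := fun y => π (f (s y)), map_add' := fun y y' => ?_,
              map_smul' := fun r y => ?_ }, fun x => key _ _ (hs _).symm⟩
    · rw [← map_add, ← map_add]
      exact key _ _ (by simp [hs])
    · rw [RingHom.id_apply, ← map_smul, ← map_smul]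
      exact key _ _ (by simp [hs])
  choose e he using hex
  have huniq : ∀ (g g' : Module.End R S), (∀ x, g (π x) = g' (π x)) → g = g' := fun g g' hg =>
    LinearMap.ext fun y => by obtain ⟨x, rfl⟩ := h.surjective y; exact hg x
  let E : Module.End R P →+* Module.End R S :=
    { toFun := e
      map_one' := huniq _ _ fun x => by simp [← he]
      map_mul' := fun f g => huniq _ _ fun x => by simp [← he]
      map_zero' := huniq _ _ fun x => by simp [← he]
      map_add' := fun f g => huniq _ _ fun x => by simp [← he] }
  refine ⟨RingEquiv.ofBijective E ⟨?_, fun g => ?_⟩, he⟩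
  · rw [injective_iff_map_eq_zero]
    intro f hf
    refine (h.isUnit_or_eq_zero K hR f).resolve_left fun hu => ?_
    obtain ⟨hb, hsurj⟩ := (Module.End.isUnit_iff f).1 hu
    have := IsSimpleModule.nontrivial R S
    obtain ⟨s, hs⟩ := exists_ne (0 : S)
    obtain ⟨x, rfl⟩ := h.surjective s
    obtain ⟨y, rfl⟩ := hsurj x
    apply hs
    rw [he]
    exact LinearMap.congr_fun hf (π y)
  · have := h.projective
    obtain ⟨f, hf⟩ := Module.projective_lifting_property π (g.comp π) h.surjective
    exact ⟨f, huniq _ _ fun x => (he f x).symm.trans (LinearMap.congr_fun hf x)⟩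

end IsProjectiveCover

end Rings

/-! ## The radical of a module and the bimodules attached to projective modules -/

section Radical

variable (R : Type v) [Ring R] (P Q : Type v) [AddCommGroup P] [Module R P] [AddCommGroup Q]
  [Module R Q]

/-- The radical `rP` of a module. -/
abbrev Rad : Type v := Module.jacobson R P

/-- The quotient `rP / r²P`. -/
abbrev RadTop : Type v := Rad R P ⧸ Module.jacobson R (Rad R P)

variable {R P}

/-- The restriction of an endomorphism of `P` to `rP`. -/
def radMap (f : Module.End R P) : Module.End R (Rad R P) :=
  f.restrict (fun _ hx => Module.le_comap_jacobson f hx)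

/-- The endomorphism of `rP / r²P` induced by an endomorphism of `P`. -/
def radTopMap (f : Module.End R P) : Module.End R (RadTop R P) :=
  Submodule.mapQ _ _ (radMap f) (Module.le_comap_jacobson (radMap f))

theorem radTopMap_one : radTopMap (1 : Module.End R P) = 1 := Submodule.linearMap_qext _ rfl

theorem radTopMap_mul (f g : Module.End R P) : radTopMap (f * g) = radTopMap f * radTopMap g :=
  Submodule.linearMap_qext _ rfl

theorem radTopMap_zero : radTopMap (0 : Module.End R P) = 0 := Submodule.linearMap_qext _ rfl

theorem radTopMap_add (f g : Module.End R P) : radTopMap (f + g) = radTopMap f + radTopMap g :=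
  Submodule.linearMap_qext _ rfl

variable (R P)

/-- `Hom_R(Q, rP)`. -/
def RadHom : Type v := Q →ₗ[R] Rad R P

/-- `Hom_R(Q, rP / r²P)`. -/
def RadTopHom : Type v := Q →ₗ[R] RadTop R P

variable {R P Q}

namespace RadHom

instance : AddCommGroup (RadHom R P Q) := inferInstanceAs (AddCommGroup (Q →ₗ[R] Rad R P))

/-- The left action of `End(P)` by composition. -/
instance : Module (Module.End R P) (RadHom R P Q) where
  smul f φ := (radMap f).comp (φ : Q →ₗ[R] Rad R P)
  one_smul _ := rfl
  mul_smul _ _ _ := rfl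
  smul_zero f := LinearMap.comp_zero (radMap f)
  smul_add f φ ψ := LinearMap.comp_add (φ : Q →ₗ[R] Rad R P) ψ (radMap f)
  add_smul _ _ _ := rfl
  zero_smul _ := rfl

/-- The right action of `End(Q)` by composition. -/
instance : Module (Module.End R Q)ᵐᵒᵖ (RadHom R P Q) where
  smul g φ := (φ : Q →ₗ[R] Rad R P).comp g.unop
  one_smul _ := rfl
  mul_smul _ _ _ := rfl
  smul_zero _ := rfl
  smul_add _ _ _ := rfl
  add_smul g h φ := LinearMap.comp_add g.unop h.unop (φ : Q →ₗ[R] Rad R P)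
  zero_smul φ := LinearMap.comp_zero (φ : Q →ₗ[R] Rad R P)

end RadHom

namespace RadTopHom

instance : AddCommGroup (RadTopHom R P Q) :=
  inferInstanceAs (AddCommGroup (Q →ₗ[R] RadTop R P))

/-- The left action of `End(P)` by composition. -/
instance : Module (Module.End R P) (RadTopHom R P Q) where
  smul f φ := (radTopMap f).comp (φ : Q →ₗ[R] RadTop R P)
  one_smul φ := congrArg (fun u => LinearMap.comp u (φ : Q →ₗ[R] RadTop R P)) radTopMap_one
  mul_smul f g φ :=
    congrArg (fun u => LinearMap.comp u (φ : Q →ₗ[R] RadTop R P)) (radTopMap_mul f g)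
  smul_zero f := LinearMap.comp_zero (radTopMap f)
  smul_add f φ ψ := LinearMap.comp_add (φ : Q →ₗ[R] RadTop R P) ψ (radTopMap f)
  add_smul f g φ :=
    congrArg (fun u => LinearMap.comp u (φ : Q →ₗ[R] RadTop R P)) (radTopMap_add f g)
  zero_smul φ := congrArg (fun u => LinearMap.comp u (φ : Q →ₗ[R] RadTop R P)) radTopMap_zero

/-- The right action of `End(Q)` by composition. -/
instance : Module (Module.End R Q)ᵐᵒᵖ (RadTopHom R P Q) where
  smul g φ := (φ : Q →ₗ[R] RadTop R P).comp g.unop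
  one_smul _ := rfl
  mul_smul _ _ _ := rfl
  smul_zero _ := rfl
  smul_add _ _ _ := rfl
  add_smul g h φ := LinearMap.comp_add g.unop h.unop (φ : Q →ₗ[R] RadTop R P)
  zero_smul φ := LinearMap.comp_zero (φ : Q →ₗ[R] RadTop R P)

instance : SMulCommClass (Module.End R P) (Module.End R Q)ᵐᵒᵖ (RadTopHom R P Q) :=
  ⟨fun _ _ _ => rfl⟩

variable {K : Type u} [Field K] [Algebra K R] [Module K P] [IsScalarTower K R P]
  [Module K Q] [IsScalarTower K R Q]

instance : Module K (RadTopHom R P Q) :=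
  inferInstanceAs (Module K (Q →ₗ[R] RadTop R P))

instance : IsScalarTower K (Module.End R P) (RadTopHom R P Q) :=
  ⟨fun c f φ =>
    have h : radTopMap (c • f) = c • radTopMap f := Submodule.linearMap_qext _ rfl
    congrArg (fun u => LinearMap.comp u (φ : Q →ₗ[R] RadTop R P)) h⟩

instance : IsScalarTower K (Module.End R Q)ᵐᵒᵖ (RadTopHom R P Q) :=
  ⟨fun c g φ =>
    have h : ∀ ψ : Q →ₗ[R] RadTop R P, ψ.comp (c • g.unop) = c • ψ.comp g.unop := fun ψ =>
      LinearMap.ext fun q => (ψ.restrictScalars K).map_smul c (g.unop q)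
    h φ⟩

theorem finite [Module.Finite K P] [Module.Finite K Q] : Module.Finite K (RadTopHom R P Q) := by
  have h1 : Module.Finite K (Rad R P) :=
    inferInstanceAs (Module.Finite K ((Module.jacobson R P).restrictScalars K))
  have h2 : Module.Finite K (RadTop R P) := Module.Finite.quotient K _
  have h3 : Module.Finite K (Q →ₗ[K] RadTop R P) := inferInstance
  have h4 : Module.Finite K (Q →ₗ[R] RadTop R P) := Module.Finite.of_injective
    (LinearMap.restrictScalarsₗ K R Q (RadTop R P) K) (LinearMap.restrictScalars_injective K)
  exact h4

end RadTopHom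

/-- Homomorphisms of `F`-`G`-bimodules. -/
structure BimoduleHom (F G M N : Type*) [Ring F] [Ring G] [AddCommGroup M] [AddCommGroup N]
    [Module F M] [Module Gᵐᵒᵖ M] [Module F N] [Module Gᵐᵒᵖ N] extends M →+ N where
  map_left_smul : ∀ (f : F) (m : M), toFun (f • m) = f • toFun m
  map_right_smul : ∀ (g : Gᵐᵒᵖ) (m : M), toFun (g • m) = g • toFun m

/-- A bimodule homomorphism has a section if it has a right inverse that is a homomorphism of
bimodules. -/
def BimoduleHom.HasSection {F G M N : Type*} [Ring F] [Ring G] [AddCommGroup M] [AddCommGroup N]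
    [Module F M] [Module Gᵐᵒᵖ M] [Module F N] [Module Gᵐᵒᵖ N] (p : BimoduleHom F G M N) : Prop :=
  ∃ σ : BimoduleHom F G N M, ∀ n, p.toAddMonoidHom (σ.toAddMonoidHom n) = n

variable (R P Q)

/-- The homomorphism `Hom_R(Q, rP) → Hom_R(Q, rP / r²P)` of `End(P)`-`End(Q)`-bimodules given by
the projection `rP → rP / r²P`. -/
def radHomProj :
    BimoduleHom (Module.End R P) (Module.End R Q) (RadHom R P Q) (RadTopHom R P Q) where
  toFun φ := (Module.jacobson R (Rad R P)).mkQ.comp (φ : Q →ₗ[R] Rad R P)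
  map_zero' := LinearMap.comp_zero _
  map_add' φ ψ := LinearMap.comp_add (φ : Q →ₗ[R] Rad R P) ψ _
  map_left_smul _ _ := rfl
  map_right_smul _ _ := rfl

theorem radHomProj_surjective [Module.Projective R Q] :
    Function.Surjective (radHomProj R P Q).toAddMonoidHom := fun φ =>
  Module.projective_lifting_property _ (φ : Q →ₗ[R] RadTop R P) (Submodule.mkQ_surjective _)

end Radical

/-! ## The modulated quiver of a hereditary algebra -/

/-- A complete list `S i` (`i ∈ ι`, finite) of the simple right modules over a `K`-algebra `Λ`, up
to isomorphism and without repetition, with a projective cover `π i : P i → S i` of each. The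
`K`-vector space structure on `P i` is the one that comes from `Λ`. -/
structure SimpleSystem (K : Type u) [Field K] (Λ : Type v) [Ring Λ] [Algebra K Λ]
    (ι : Type w) where
  S : ι → Type v
  [addCommGroupS : ∀ i, AddCommGroup (S i)]
  [moduleS : ∀ i, Module Λᵐᵒᵖ (S i)]
  [simpleS : ∀ i, IsSimpleModule Λᵐᵒᵖ (S i)]
  eq_of_iso : ∀ i j, Nonempty (S i ≃ₗ[Λᵐᵒᵖ] S j) → i = j
  exists_iso : ∀ (X : Type v) [AddCommGroup X] [Module Λᵐᵒᵖ X] [IsSimpleModule Λᵐᵒᵖ X],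
    ∃ i, Nonempty (X ≃ₗ[Λᵐᵒᵖ] S i)
  P : ι → Type v
  [addCommGroupP : ∀ i, AddCommGroup (P i)]
  [moduleP : ∀ i, Module Λᵐᵒᵖ (P i)]
  [moduleKP : ∀ i, Module K (P i)]
  [towerP : ∀ i, IsScalarTower K Λᵐᵒᵖ (P i)]
  π : ∀ i, P i →ₗ[Λᵐᵒᵖ] S i
  cover : ∀ i, IsProjectiveCover (π i)

namespace SimpleSystem

attribute [instance] addCommGroupS moduleS simpleS addCommGroupP moduleP moduleKP towerP

variable {K : Type u} [Field K] {Λ : Type v} [Ring Λ] [Algebra K Λ] {ι : Type w}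
  (D : SimpleSystem K Λ ι)

/-- There is an arrow `i → j` if `Ext¹(S i, S j) ≠ 0`. -/
def Arrow (i j : ι) : Prop :=
  Nontrivial (Abelian.Ext (ModuleCat.of Λᵐᵒᵖ (D.S i)) (ModuleCat.of Λᵐᵒᵖ (D.S j)) 1)

theorem exists_of_arrow {i j : ι} (h : D.Arrow i j) :
    ∃ φ : LinearMap.ker (D.π i) →ₗ[Λᵐᵒᵖ] D.S j, φ ≠ 0 := by
  by_contra! hall
  have hproj := (D.cover i).projective
  let C : ShortComplex (ModuleCat.{v} Λᵐᵒᵖ) := ShortComplex.mk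
    (ModuleCat.ofHom (LinearMap.ker (D.π i)).subtype) (ModuleCat.ofHom (D.π i)) (by
      ext x; exact x.2)
  have hC : C.ShortExact := by
    refine ShortComplex.ShortExact.mk' ?_ ?_ ?_
    · rw [ShortComplex.moduleCat_exact_iff]
      intro x hx
      exact ⟨⟨x, hx⟩, rfl⟩
    · exact (ModuleCat.mono_iff_injective _).2 Subtype.val_injective
    · exact (ModuleCat.epi_iff_surjective _).2 (D.cover i).surjective
  have : Projective C.X₂ := by
    have : Module.Projective Λᵐᵒᵖ C.X₂ := hproj
    exact (IsProjective.iff_projective _ ).1 this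
  obtain ⟨x, hx⟩ := @exists_ne _ h 0
  apply hx
  obtain ⟨y, hy⟩ := Abelian.Ext.contravariant_sequence_exact₃ hC
    (ModuleCat.of Λᵐᵒᵖ (D.S j)) x (Abelian.Ext.eq_zero_of_projective _) (add_comm 1 0)
  obtain ⟨f, rfl⟩ := (Abelian.Ext.mk₀_bijective _ _).2 y
  have hf : f = 0 := ModuleCat.hom_ext (hall f.hom)
  rw [← hy, hf, Abelian.Ext.mk₀_zero, Abelian.Ext.comp_zero]

variable [Module.Finite K Λ]

theorem finrank_lt_of_arrow (hΛ : IsRightHereditary Λ) {i j : ι} (h : D.Arrow i j) :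
    Module.finrank K (D.P j) < Module.finrank K (D.P i) := by
  have : Module.Finite K Λᵐᵒᵖ := Module.Finite.equiv (MulOpposite.opLinearEquiv K)
  have := (D.cover i).finite K
  have := (D.cover j).projective
  obtain ⟨φ, hφ⟩ := D.exists_of_arrow h
  have hs : Function.Surjective φ := LinearMap.surjective_of_ne_zero hφ
  obtain ⟨g, hg⟩ := Module.projective_lifting_property φ (D.π j) hs
  have hg0 : (LinearMap.ker (D.π i)).subtype.comp g ≠ 0 := by
    intro h0
    have hz : g = 0 := LinearMap.ext fun x => Subtype.ext (LinearMap.congr_fun h0 x)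
    have hπ : D.π j = 0 := by rw [← hg, hz, LinearMap.comp_zero]
    have := IsSimpleModule.nontrivial Λᵐᵒᵖ (D.S j)
    obtain ⟨s, hs⟩ := exists_ne (0 : D.S j)
    obtain ⟨x, rfl⟩ := (D.cover j).surjective s
    exact hs (by rw [hπ]; rfl)
  have hinj := (D.cover j).injective_of_ne_zero (D.cover i) hΛ _ hg0
  let q : D.P j →ₗ[K] D.P i :=
    ((LinearMap.ker (D.π i)).subtype.comp g).restrictScalars K
  rw [← LinearMap.finrank_range_of_inj (f := q) hinj]
  refine Submodule.finrank_lt fun htop => ?_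
  have := IsSimpleModule.nontrivial Λᵐᵒᵖ (D.S i)
  obtain ⟨s, hs⟩ := exists_ne (0 : D.S i)
  obtain ⟨x, rfl⟩ := (D.cover i).surjective s
  obtain ⟨y, rfl⟩ := LinearMap.range_eq_top.1 htop x
  exact hs (g y).2

theorem acyclic (hΛ : IsRightHereditary Λ) (i : ι) : ¬ Relation.TransGen D.Arrow i i := by
  have key : ∀ i j, Relation.TransGen D.Arrow i j →
      Module.finrank K (D.P j) < Module.finrank K (D.P i) := by
    intro i j h
    induction h with
    | single h => exact D.finrank_lt_of_arrow hΛ h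
    | tail _ h ih => exact (D.finrank_lt_of_arrow hΛ h).trans ih
  exact fun h => lt_irrefl _ (key i i h)

/-- `F i = End(P i)`, a division algebra over `K` since `Λ` is hereditary. -/
noncomputable abbrev divisionRing (hΛ : IsRightHereditary Λ) (i : ι) :
    DivisionRing (Module.End Λᵐᵒᵖ (D.P i)) :=
  have : Module.Finite K Λᵐᵒᵖ := Module.Finite.equiv (MulOpposite.opLinearEquiv K)
  have := (D.cover i).nontrivial
  DivisionRing.ofIsUnitOrEqZero ((D.cover i).isUnit_or_eq_zero K hΛ)

/-- The modulated quiver of a finite dimensional hereditary algebra: there is an arrow `i → j` if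
`Ext¹(S i, S j) ≠ 0`, `F i = End(P i)` (which is identified with `End(S i)`), and `M i j` is the
`F i`-`F j`-bimodule `Hom(P j, rP i / r²P i)`. -/
noncomputable def modulatedQuiver [Fintype ι] (hΛ : IsRightHereditary Λ) :
    ModulatedQuiver.{u, v, w} K :=
  have : Module.Finite K Λᵐᵒᵖ := Module.Finite.equiv (MulOpposite.opLinearEquiv K)
  have : ∀ i, Module.Finite K (D.P i) := fun i => (D.cover i).finite K
  { V := ι
    Arrow := D.Arrow
    acyclic := D.acyclic hΛ
    F := fun i => Module.End Λᵐᵒᵖ (D.P i)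
    divisionRingF := D.divisionRing hΛ
    algebraF := fun i => inferInstanceAs (Algebra K (Module.End Λᵐᵒᵖ (D.P i)))
    finiteF := fun i => Module.Finite.of_injective
      (LinearMap.restrictScalarsₗ K Λᵐᵒᵖ (D.P i) (D.P i) K) (LinearMap.restrictScalars_injective K)
    M := fun i j _ => RadTopHom Λᵐᵒᵖ (D.P i) (D.P j)
    addCommGroupM := fun _ _ _ => inferInstance
    moduleM := fun _ _ _ => inferInstance
    leftModuleM := fun i j _ =>
      inferInstanceAs (Module (Module.End Λᵐᵒᵖ (D.P i)) (RadTopHom Λᵐᵒᵖ (D.P i) (D.P j)))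
    rightModuleM := fun i j _ =>
      inferInstanceAs (Module (Module.End Λᵐᵒᵖ (D.P j))ᵐᵒᵖ (RadTopHom Λᵐᵒᵖ (D.P i) (D.P j)))
    bimoduleM := fun i j _ => inferInstanceAs (SMulCommClass (Module.End Λᵐᵒᵖ (D.P i))
      (Module.End Λᵐᵒᵖ (D.P j))ᵐᵒᵖ (RadTopHom Λᵐᵒᵖ (D.P i) (D.P j)))
    leftTowerM := fun i j _ => inferInstanceAs (IsScalarTower K (Module.End Λᵐᵒᵖ (D.P i))
      (RadTopHom Λᵐᵒᵖ (D.P i) (D.P j)))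
    rightTowerM := fun i j _ => inferInstanceAs (IsScalarTower K
      (Module.End Λᵐᵒᵖ (D.P j))ᵐᵒᵖ (RadTopHom Λᵐᵒᵖ (D.P i) (D.P j)))
    finiteM := fun _ _ _ => RadTopHom.finite }

end SimpleSystem

/-!
If the epimorphisms `Hom(P_j, rP_i) → M_ij` have bimodule sections, then the `F_i` and the images
of these sections in `Hom(P_j, P_i)` are the vertices and arrows of a representation of
`T(Q, M)` on `P = ⨁ P_i`. Since `Λ` is hereditary, `rP_i` is projective, so bases of the `M_ij`
lift to a decomposition of `rP_i` into summands `P_j`. By induction on `dim P_i`, it follows that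
the path sums from `i` to `k` map bijectively onto `Hom(P_k, P_i)`, hence that `T(Q, M) ≅ End P`;
and `P` is a progenerator.

Conversely, let `Q` be any modulated quiver whose tensor algebra is Morita equivalent to `Λ`. The
equivalence gives a projective generator `Z` with `End Z ≅ T(Q)`, and the vertex idempotents of
`T(Q)` split off from `Z` exactly the `P_i`. This identifies `Hom(P_j, P_i)` with the path sums from
`i` to `j`, compatibly with compositions. For `i ≠ j` every homomorphism `P_j → P_i` has its values
in `rP_i`, and those with values in `r²P_i` correspond to the combinations of paths of length at
least two. The paths of length one span a complement of these that is stable under `F_i` and `F_j`,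
which is a section.
-/

/-! ## Progenerators -/

section Generator

variable {A : Type u} {P : Type v} {X Y : Type*} [Ring A] [AddCommGroup P] [Module A P]
  [AddCommGroup X] [Module A X] [AddCommGroup Y] [Module A Y]

variable (A P) in
/-- `P` is a generator of the category of `A`-modules, encoded by the condition that its trace
ideal is the unit ideal; unlike Mathlib's `IsSeparator`, this does not constrain universes. -/
def IsGeneratorModule : Prop := ⨆ f : P →ₗ[A] A, LinearMap.range f = ⊤

theorem isGeneratorModule_of_forall_isCoatom
    (h : ∀ W : Submodule A A, IsCoatom W → ∃ f : P →ₗ[A] A, W.mkQ ∘ₗ f ≠ 0) :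
    IsGeneratorModule A P := by
  refine (eq_top_or_exists_le_coatom _).resolve_right ?_
  rintro ⟨W, hW, hle⟩
  obtain ⟨f, hf⟩ := h W hW
  exact hf (LinearMap.ext fun p =>
    (Submodule.Quotient.mk_eq_zero W).2 (hle (le_iSup LinearMap.range f ⟨p, rfl⟩)))

namespace IsGeneratorModule

theorem exists_sum_eq_one (hP : IsGeneratorModule A P) :
    ∃ (s : Finset (P →ₗ[A] A)) (p : (P →ₗ[A] A) → P), ∑ f ∈ s, f (p f) = 1 := by
  obtain ⟨c, hc, hsum⟩ := (Submodule.mem_iSup_iff_exists_finsupp _ _).1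
    (hP ▸ Submodule.mem_top : (1 : A) ∈ ⨆ f : P →ₗ[A] A, LinearMap.range f)
  choose p hp using hc
  exact ⟨c.support, p, by simpa only [hp, Finsupp.sum] using hsum⟩

theorem exists_comp_comp_apply_ne_zero (hP : IsGeneratorModule A P) [Module.Projective A X]
    (g : X →ₗ[A] Y) {x : X} (hx : g x ≠ 0) :
    ∃ (s : X →ₗ[A] P) (t : P →ₗ[A] X), g (t (s x)) ≠ 0 := by
  obtain ⟨c, p, hsum⟩ := hP.exists_sum_eq_one
  obtain ⟨σ, hσ⟩ := Module.projective_def'.1 ‹Module.Projective A X›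
  by_contra! h
  have hzero (y : X) : σ x y • g y = 0 := by
    rw [← mul_one (σ x y), ← hsum, Finset.mul_sum, Finset.sum_smul]
    refine Finset.sum_eq_zero fun f _ => ?_
    simpa [mul_smul] using h ((Finsupp.lapply y ∘ₗ σ).smulRight (p f)) (f.smulRight y)
  apply hx
  rw [← LinearMap.id_apply (R := A) x, ← hσ, LinearMap.comp_apply, Finsupp.linearCombination_apply,
    Finsupp.sum, map_sum]
  exact Finset.sum_eq_zero fun y _ => by simpa using hzero y

end IsGeneratorModule

theorem exists_dual_basis (A P : Type*) [Ring A] [AddCommGroup P] [Module A P]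
    [Module.Finite A P] [Module.Projective A P] :
    ∃ (n : ℕ) (q : Fin n → P) (g : Fin n → P →ₗ[A] A), ∀ x, ∑ c, g c x • q c = x := by
  obtain ⟨n, f, s, -, -, hs⟩ := Module.Finite.exists_comp_eq_id_of_projective A P
  refine ⟨n, fun c => f (Pi.single c 1), fun c => LinearMap.proj c ∘ₗ s, fun x => ?_⟩
  conv_rhs => rw [← LinearMap.id_apply (R := A) x, ← hs, LinearMap.comp_apply,
    ← Finset.univ_sum_single (s x), map_sum]
  refine Finset.sum_congr rfl fun c _ => ?_
  rw [LinearMap.comp_apply, LinearMap.proj_apply, ← map_smul, ← Pi.single_smul, smul_eq_mul,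
    mul_one]

theorem IsGeneratorModule.exists_sum_comp_eq_id (hP : IsGeneratorModule A P) [Module.Finite A X]
    [Module.Projective A X] : ∃ (α : Type (max u v)) (_ : Fintype α) (s : α → X →ₗ[A] P)
      (t : α → P →ₗ[A] X), ∑ a, t a ∘ₗ s a = LinearMap.id := by
  obtain ⟨c, p, hsum⟩ := hP.exists_sum_eq_one
  obtain ⟨n, q, g, hqg⟩ := exists_dual_basis A X
  refine ⟨Fin n × c, inferInstance, fun a => (g a.1).smulRight (p a.2),
    fun a => (a.2 : P →ₗ[A] A).smulRight (q a.1), LinearMap.ext fun x => ?_⟩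
  simp only [LinearMap.sum_apply, LinearMap.comp_apply, LinearMap.smulRight_apply, map_smul,
    Fintype.sum_prod_type]
  conv_rhs => rw [LinearMap.id_apply, ← hqg x]
  refine Finset.sum_congr rfl fun i _ => ?_
  rw [← Finset.smul_sum, ← Finset.sum_smul, Finset.sum_coe_sort c (fun f => f (p f)), hsum,
    one_smul]

end Generator

section Morita

universe u₁ u₂

variable {A : Type u₁} [Ring A] {B : Type u₂} [Ring B]

/-- The left `B`-module structure on `Hom_A(P, X)` coming from an `A`-`B`-bimodule `P`. -/
abbrev homModule {P X : Type*} [AddCommGroup P] [Module A P] [Module Bᵐᵒᵖ P]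
    [SMulCommClass A Bᵐᵒᵖ P] [AddCommGroup X] [Module A X] : Module B (P →ₗ[A] X) :=
  Module.compHom (R := Bᵐᵒᵖᵈᵐᵃ) _ (RingEquiv.opOp B).toRingHom

attribute [local instance] homModule

section Bimodule

variable {P X Y : Type*} [AddCommGroup P] [Module A P] [Module Bᵐᵒᵖ P] [SMulCommClass A Bᵐᵒᵖ P]
  [AddCommGroup X] [Module A X] [AddCommGroup Y] [Module A Y]

theorem homModule_smul_apply (b : B) (f : P →ₗ[A] X) (p : P) :
    (b • f) p = f (MulOpposite.op b • p) := rfl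

instance smulCommClass_homModule : SMulCommClass B Aᵐᵒᵖ (P →ₗ[A] A) := ⟨fun _ _ _ => rfl⟩

variable (B P) in
/-- The `B`-linear map `Hom_A(P, X) → Hom_A(P, Y)` induced by `X → Y`. -/
def homMap (g : X →ₗ[A] Y) : (P →ₗ[A] X) →ₗ[B] (P →ₗ[A] Y) where
  toFun f := g ∘ₗ f
  map_add' _ _ := LinearMap.comp_add _ _ _
  map_smul' _ _ := rfl

theorem homMap_injective (hP : IsGeneratorModule A P) :
    Function.Injective (homMap B P : (X →ₗ[A] Y) → _) := by
  obtain ⟨s, p, hsp⟩ := hP.exists_sum_eq_one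
  intro g g' h
  ext x
  rw [← one_smul A x, ← hsp, Finset.sum_smul, map_sum, map_sum]
  exact Finset.sum_congr rfl fun f _ =>
    LinearMap.congr_fun (LinearMap.congr_fun h (f.smulRight x)) (p f)

theorem homMap_surjective (hP : IsGeneratorModule A P)
    (hB : ∀ g : Module.End A P, ∃ b : B, ∀ p : P, MulOpposite.op b • p = g p) :
    Function.Surjective (homMap B P : (X →ₗ[A] Y) → _) := by
  obtain ⟨s, p, hsp⟩ := hP.exists_sum_eq_one
  intro h
  let g : X →+ Y :=
    { toFun x := ∑ f ∈ s, h (f.smulRight x) (p f)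
      map_zero' := by simp
      map_add' x y := by
        rw [← Finset.sum_add_distrib]
        refine Finset.sum_congr rfl fun f _ => ?_
        rw [← LinearMap.add_apply, ← map_add]
        congr 2
        ext; simp }
  -- Since `f(-) ψ(q) = b ψ` for the scalar `b` acting on `P` as `f(-) q`, linearity of `h` moves
  -- `h` inside, and then the coefficients `f (p f)` sum to `1`.
  have apply_hom (ψ : P →ₗ[A] X) (q : P) : g (ψ q) = h ψ q := by
    suffices key : ∀ f, h (f.smulRight (ψ q)) (p f) = f (p f) • h ψ q by
      change ∑ f ∈ s, _ = _
      simp only [key, ← Finset.sum_smul, hsp, one_smul]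
    intro f
    obtain ⟨b, hb⟩ := hB (f.smulRight q)
    have hψ : f.smulRight (ψ q) = b • ψ := by
      ext r; simp [homModule_smul_apply, hb]
    rw [hψ, map_smul, homModule_smul_apply, hb, LinearMap.smulRight_apply, map_smul]
  have map_smul_g (a : A) (x : X) : g (a • x) = a • g x := by
    have hx : x = ∑ f ∈ s, f.smulRight x (p f) := by
      simp [← Finset.sum_smul, hsp]
    conv_lhs => rw [hx]
    simp only [Finset.smul_sum, map_sum, ← map_smul (LinearMap.smulRight _ _), apply_hom]
    simp only [map_smul, ← Finset.smul_sum]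
    rfl
  exact ⟨{ g with map_smul' := map_smul_g },
    LinearMap.ext fun ψ => LinearMap.ext fun q => apply_hom ψ q⟩

end Bimodule

section Dyad

variable {P : Type*} [AddCommGroup P] [Module A P] [Module Bᵐᵒᵖ P]
  (hB : ∀ g : Module.End A P, ∃! b : B, ∀ p : P, MulOpposite.op b • p = g p)

/-- The element of `B` that acts on `P` as the rank one endomorphism `q ↦ φ(q) p`. -/
noncomputable def dyad (p : P) (φ : P →ₗ[A] A) : B := (hB (φ.smulRight p)).choose

theorem op_dyad_smul (p : P) (φ : P →ₗ[A] A) (q : P) :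
    MulOpposite.op (dyad hB p φ) • q = φ q • p :=
  (hB (φ.smulRight p)).choose_spec.1 q

variable [SMulCommClass A Bᵐᵒᵖ P]

include hB in
theorem eq_of_forall_op_smul_eq {b c : B}
    (h : ∀ q : P, MulOpposite.op b • q = MulOpposite.op c • q) : b = c :=
  have := SMulCommClass.symm A Bᵐᵒᵖ P
  (hB (Module.toModuleEnd A P (MulOpposite.op c))).unique h fun _ => rfl

theorem dyad_add_left (p q : P) (φ : P →ₗ[A] A) :
    dyad hB (p + q) φ = dyad hB p φ + dyad hB q φ :=
  eq_of_forall_op_smul_eq hB fun r => by simp [op_dyad_smul, add_smul]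

theorem dyad_add_right (p : P) (φ ψ : P →ₗ[A] A) :
    dyad hB p (φ + ψ) = dyad hB p φ + dyad hB p ψ :=
  eq_of_forall_op_smul_eq hB fun r => by simp [op_dyad_smul, add_smul]

theorem dyad_smul_left (a : A) (p : P) (φ : P →ₗ[A] A) :
    dyad hB (a • p) φ = dyad hB p (MulOpposite.op a • φ) :=
  eq_of_forall_op_smul_eq hB fun r => by simp [op_dyad_smul, mul_smul]

theorem dyad_op_smul_left (b : B) (p : P) (φ : P →ₗ[A] A) :
    dyad hB (MulOpposite.op b • p) φ = dyad hB p φ * b :=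
  eq_of_forall_op_smul_eq hB fun r => by simp [op_dyad_smul, mul_smul, smul_comm]

theorem dyad_smul_right (b : B) (p : P) (φ : P →ₗ[A] A) :
    dyad hB p (b • φ) = b * dyad hB p φ :=
  eq_of_forall_op_smul_eq hB fun r => by simp [op_dyad_smul, mul_smul, homModule_smul_apply]

variable (N : Type*) [AddCommGroup N] [Module B N]

/-- The unit `N → Hom_A(P, Hom_B(P*, N))` of the adjunction between the functors `Hom_A(P, -)` and
`Hom_B(P*, -)`, where `P* = Hom_A(P, A)`. -/
noncomputable def coinducedUnit : N →ₗ[B] P →ₗ[A] (P →ₗ[A] A) →ₗ[B] N where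
  toFun n :=
    { toFun p :=
        { toFun φ := dyad hB p φ • n
          map_add' φ ψ := by rw [dyad_add_right, add_smul]
          map_smul' b φ := by rw [dyad_smul_right, mul_smul, RingHom.id_apply] }
      map_add' p q := LinearMap.ext fun φ => by
        simp [dyad_add_left, add_smul]
      map_smul' a p := LinearMap.ext fun φ => by
        simp [dyad_smul_left, homModule_smul_apply] }
  map_add' n n' := by ext; simp
  map_smul' b n := by ext; simp [homModule_smul_apply, dyad_op_smul_left, mul_smul]

theorem coinducedUnit_apply (n : N) (p : P) (φ : P →ₗ[A] A) :
    coinducedUnit hB N n p φ = dyad hB p φ • n := rfl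

theorem coinducedUnit_bijective [Module.Finite A P] [Module.Projective A P] :
    Function.Bijective (coinducedUnit hB N) := by
  obtain ⟨n, q, g, hgq⟩ := exists_dual_basis A P
  have sum_dyad : ∑ c, dyad hB (q c) (g c) = 1 :=
    eq_of_forall_op_smul_eq hB fun p => by simp [Finset.sum_smul, op_dyad_smul, hgq]
  constructor
  · rw [injective_iff_map_eq_zero]
    intro x hx
    rw [← one_smul B x, ← sum_dyad, Finset.sum_smul]
    exact Finset.sum_eq_zero fun c _ => by rw [← coinducedUnit_apply, hx]; rfl
  · intro H
    refine ⟨∑ c, H (q c) (g c), ?_⟩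
    ext p φ
    have hφ (c) : dyad hB p φ • g c = MulOpposite.op (g c p) • φ := by
      ext r
      simp [homModule_smul_apply, op_dyad_smul]
    conv_rhs => rw [← hgq p]
    simp only [coinducedUnit_apply, Finset.smul_sum, ← map_smul, hφ]
    simp [homModule_smul_apply]

end Dyad

variable {K : Type*} [CommRing K] [Algebra K A] [Algebra K B] {P : Type (max u₁ u₂)}
  [AddCommGroup P] [Module A P]

variable (B P) in
/-- The functor `Hom_A(P, -)` given by an `A`-`B`-bimodule `P`. -/
def homFunctor [Module Bᵐᵒᵖ P] [SMulCommClass A Bᵐᵒᵖ P] :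
    ModuleCat.{max u₁ u₂} A ⥤ ModuleCat.{max u₁ u₂} B where
  obj X := ModuleCat.of B (P →ₗ[A] X)
  map g := ModuleCat.ofHom (homMap B P g.hom)

theorem isEquivalence_homFunctor [Module Bᵐᵒᵖ P] [SMulCommClass A Bᵐᵒᵖ P]
    (hP : IsGeneratorModule A P) [Module.Finite A P] [Module.Projective A P]
    (hB : ∀ g : Module.End A P, ∃! b : B, ∀ p : P, MulOpposite.op b • p = g p) :
    (homFunctor (A := A) B P).IsEquivalence where
  faithful := ⟨fun h => ModuleCat.hom_ext (homMap_injective hP (congrArg ModuleCat.Hom.hom h))⟩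
  full := ⟨fun h => by
    obtain ⟨g, hg⟩ := homMap_surjective hP (fun g => (hB g).exists) h.hom
    exact ⟨ModuleCat.ofHom g, ModuleCat.hom_ext hg⟩⟩
  essSurj := ⟨fun N => ⟨ModuleCat.of A ((P →ₗ[A] A) →ₗ[B] N),
    ⟨(LinearEquiv.ofBijective _ (coinducedUnit_bijective hB N)).symm.toModuleIso⟩⟩⟩

open scoped ModuleCat.Algebra in
theorem linear_homFunctor [Module K P] [IsScalarTower K A P] [Module Bᵐᵒᵖ P]
    [SMulCommClass A Bᵐᵒᵖ P] [IsScalarTower K Bᵐᵒᵖ P] : (homFunctor (A := A) B P).Linear K where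
  map_smul {X Y} g k := by
    refine ModuleCat.hom_ext (LinearMap.ext fun f : P →ₗ[A] X => LinearMap.ext fun p => ?_)
    have hk : algebraMap K Bᵐᵒᵖ k • p = algebraMap K A k • p := by
      rw [algebraMap_smul, algebraMap_smul]
    change algebraMap K A k • g.hom (f p) = g.hom (f (algebraMap K Bᵐᵒᵖ k • p))
    rw [hk, map_smul, map_smul]

open scoped ModuleCat.Algebra in
theorem isMoritaEquivalent_of_isGeneratorModule [Module K P] [IsScalarTower K A P]
    (hP : IsGeneratorModule A P) [Module.Finite A P] [Module.Projective A P]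
    (e : Bᵐᵒᵖ ≃ₐ[K] Module.End A P) : IsMoritaEquivalent K A B := by
  let : Module Bᵐᵒᵖ P := Module.compHom P e.toRingHom
  have : SMulCommClass A Bᵐᵒᵖ P := ⟨fun a b p => (map_smul (e b) a p).symm⟩
  have : IsScalarTower K Bᵐᵒᵖ P := ⟨fun k b p => LinearMap.congr_fun (map_smul e k b) p⟩
  have hB (g : Module.End A P) : ∃! b : B, ∀ p : P, MulOpposite.op b • p = g p :=
    ⟨(e.symm g).unop, fun p => LinearMap.congr_fun (e.apply_symm_apply g) p, fun b hb =>
      MulOpposite.op_injective (e.injective (LinearMap.ext fun p =>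
        (hb p).trans (LinearMap.congr_fun (e.apply_symm_apply g) p).symm))⟩
  have := isEquivalence_homFunctor hP hB
  exact ⟨⟨(homFunctor B P).asEquivalence, linear_homFunctor⟩⟩

end Morita

/-! ## Projective covers and radicals -/

theorem exists_comp_subtype_ker_eq {R : Type v} [Ring R] {P S T : Type v} [AddCommGroup P]
    [Module R P] [AddCommGroup S] [Module R S] [AddCommGroup T] [Module R T] {π : P →ₗ[R] S}
    (hπ : Function.Surjective π)
    [Subsingleton (Abelian.Ext (ModuleCat.of R S) (ModuleCat.of R T) 1)]
    (φ : LinearMap.ker π →ₗ[R] T) : ∃ f : P →ₗ[R] T, f ∘ₗ (LinearMap.ker π).subtype = φ := by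
  let C : ShortComplex (ModuleCat.{v} R) := ShortComplex.mk
    (ModuleCat.ofHom (LinearMap.ker π).subtype) (ModuleCat.ofHom π) (by ext x; exact x.2)
  have hC : C.ShortExact := ShortComplex.ShortExact.mk'
    ((ShortComplex.moduleCat_exact_iff C).2 fun x hx => ⟨⟨x, hx⟩, rfl⟩)
    ((ModuleCat.mono_iff_injective _).2 Subtype.val_injective)
    ((ModuleCat.epi_iff_surjective _).2 hπ)
  obtain ⟨x, hx⟩ := Abelian.Ext.contravariant_sequence_exact₁ hC (ModuleCat.of R T)
    (Abelian.Ext.mk₀ (ModuleCat.ofHom φ)) (add_comm 1 0) (Subsingleton.elim _ _)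
  obtain ⟨f, rfl⟩ := (Abelian.Ext.mk₀_bijective _ _).2 x
  rw [Abelian.Ext.mk₀_comp_mk₀] at hx
  exact ⟨f.hom, congrArg ModuleCat.Hom.hom ((Abelian.Ext.mk₀_bijective _ _).1 hx)⟩

theorem exists_isCoatom_notMem_of_notMem_jacobson {R M : Type*} [Ring R] [AddCommGroup M]
    [Module R M] {x : M} (hx : x ∉ Module.jacobson R M) :
    ∃ W : Submodule R M, IsCoatom W ∧ x ∉ W := by
  by_contra! h
  exact hx (Submodule.mem_sInf.2 h)

theorem injective_of_ker_le_jacobson {R M N : Type*} [Ring R] [AddCommGroup M] [Module R M]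
    [AddCommGroup N] [Module R N] [Module.Finite R M] [Module.Projective R N] {f : M →ₗ[R] N}
    (hf : Function.Surjective f) (hker : LinearMap.ker f ≤ Module.jacobson R M) :
    Function.Injective f := by
  obtain ⟨s, hs⟩ := Module.projective_lifting_property f LinearMap.id hf
  have hfs (y : N) : f (s y) = y := LinearMap.congr_fun hs y
  have hrange : LinearMap.range s = ⊤ := by
    by_contra hne
    obtain ⟨W, hW, hle⟩ := (eq_top_or_exists_le_coatom (LinearMap.range s)).resolve_left hne
    refine hW.1 (eq_top_iff.2 fun x _ => ?_)
    have hmem : x - s (f x) ∈ LinearMap.ker f := by rw [LinearMap.mem_ker, map_sub, hfs, sub_self]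
    have hx : x - s (f x) ∈ W := (sInf_le hW : Module.jacobson R M ≤ W) (hker hmem)
    exact (W.sub_mem_iff_left (hle ⟨f x, rfl⟩)).1 hx
  have hsf := Function.LeftInverse.rightInverse_of_surjective hfs (LinearMap.range_eq_top.1 hrange)
  exact hsf.injective

namespace IsProjectiveCover

variable {R : Type v} [Ring R] {P S : Type*} [AddCommGroup P] [Module R P] [AddCommGroup S]
  [Module R S] [IsSimpleModule R S] {π : P →ₗ[R] S}

theorem isCoatom_ker (h : IsProjectiveCover π) : IsCoatom (LinearMap.ker π) :=
  LinearMap.isCoatom_ker_of_surjective h.surjective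

theorem eq_ker_of_isCoatom (h : IsProjectiveCover π) {N : Submodule R P} (hN : IsCoatom N) :
    N = LinearMap.ker π := by
  have hle : N ≤ LinearMap.ker π := not_not.1 fun hle => hN.1 (h.eq_top_of_not_le hle)
  exact ((hN.le_iff.1 hle).resolve_left h.isCoatom_ker.1).symm

theorem jacobson_eq_ker (h : IsProjectiveCover π) : Module.jacobson R P = LinearMap.ker π :=
  le_antisymm (sInf_le h.isCoatom_ker) (le_sInf fun _ hN => (h.eq_ker_of_isCoatom hN).ge)

theorem ne_zero (h : IsProjectiveCover π) : π ≠ 0 := by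
  rintro rfl
  exact h.isCoatom_ker.1 LinearMap.ker_zero

theorem nonempty_equiv_of_ne_zero (h : IsProjectiveCover π) {S' : Type*} [AddCommGroup S']
    [Module R S'] [IsSimpleModule R S'] {f : P →ₗ[R] S'} (hf : f ≠ 0) :
    Nonempty (S' ≃ₗ[R] S) := by
  have hs : Function.Surjective f := LinearMap.surjective_of_ne_zero hf
  have hker := h.eq_ker_of_isCoatom (LinearMap.isCoatom_ker_of_surjective hs)
  exact ⟨(f.quotKerEquivOfSurjective hs).symm ≪≫ₗ Submodule.quotEquivOfEq _ _ hker ≪≫ₗ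
    π.quotKerEquivOfSurjective h.surjective⟩

end IsProjectiveCover

namespace SimpleSystem

variable {K : Type u} [Field K] {Λ : Type v} [Ring Λ] [Algebra K Λ] {ι : Type w}
  (D : SimpleSystem K Λ ι)

theorem mem_jacobson_of_ne {i j : ι} (hij : i ≠ j) (f : D.P j →ₗ[Λᵐᵒᵖ] D.P i) (x : D.P j) :
    f x ∈ Module.jacobson Λᵐᵒᵖ (D.P i) := by
  rw [(D.cover i).jacobson_eq_ker]
  by_contra hx
  exact hij (D.eq_of_iso i j ((D.cover j).nonempty_equiv_of_ne_zero (f := D.π i ∘ₗ f)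
    fun h => hx (LinearMap.congr_fun h x)))

theorem comp_eq_zero_of_ne {i j k : ι} (hjk : j ≠ k) (m : D.P j →ₗ[Λᵐᵒᵖ] RadTop Λᵐᵒᵖ (D.P i))
    (f : D.P k →ₗ[Λᵐᵒᵖ] D.P j) : m ∘ₗ f = 0 := by
  refine LinearMap.ext fun x => ?_
  have h := Module.le_comap_jacobson m (D.mem_jacobson_of_ne hjk f x)
  rwa [Submodule.mem_comap, Module.jacobson_quotient_jacobson, Submodule.mem_bot] at h

theorem exists_mkQ_comp_ne_zero {X : Type v} [AddCommGroup X] [Module Λᵐᵒᵖ X]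
    {W : Submodule Λᵐᵒᵖ X} (hW : IsCoatom W) :
    ∃ (k : ι) (f : D.P k →ₗ[Λᵐᵒᵖ] X), W.mkQ ∘ₗ f ≠ 0 := by
  have := isSimpleModule_iff_isCoatom.2 hW
  obtain ⟨k, ⟨e⟩⟩ := D.exists_iso (X ⧸ W)
  have := (D.cover k).projective
  obtain ⟨f, hf⟩ := Module.projective_lifting_property W.mkQ (e.symm.toLinearMap ∘ₗ D.π k)
    W.mkQ_surjective
  refine ⟨k, f, fun h => (D.cover k).ne_zero (LinearMap.ext fun x => e.symm.injective ?_)⟩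
  simpa using LinearMap.congr_fun (hf.symm.trans h) x

theorem isGeneratorModule_pi : IsGeneratorModule Λᵐᵒᵖ (∀ i, D.P i) := by
  refine isGeneratorModule_of_forall_isCoatom fun W hW => ?_
  obtain ⟨k, f, hf⟩ := D.exists_mkQ_comp_ne_zero hW
  refine ⟨f ∘ₗ LinearMap.proj k, fun h => hf (LinearMap.ext fun x => ?_)⟩
  classical
  simpa using LinearMap.congr_fun h (Pi.single k x)

section Factorization

variable [Finite ι] {X Y : Type*} [AddCommGroup X] [Module Λᵐᵒᵖ X] [AddCommGroup Y]
  [Module Λᵐᵒᵖ Y] [Module.Projective Λᵐᵒᵖ X]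

theorem exists_comp_comp_apply_ne_zero (g : X →ₗ[Λᵐᵒᵖ] Y) {x : X} (hx : g x ≠ 0) :
    ∃ (k : ι) (s : X →ₗ[Λᵐᵒᵖ] D.P k) (t : D.P k →ₗ[Λᵐᵒᵖ] X), g (t (s x)) ≠ 0 := by
  classical
  cases nonempty_fintype ι
  obtain ⟨s, t, hst⟩ := D.isGeneratorModule_pi.exists_comp_comp_apply_ne_zero g hx
  rw [← Finset.univ_sum_single (s x), map_sum, map_sum] at hst
  obtain ⟨k, -, hk⟩ := Finset.exists_ne_zero_of_sum_ne_zero hst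
  exact ⟨k, LinearMap.proj k ∘ₗ s, t ∘ₗ LinearMap.single _ _ k, hk⟩

theorem exists_sum_comp_eq_id [Module.Finite Λᵐᵒᵖ X] :
    ∃ (α : Type (max v w)) (_ : Fintype α) (k : α → ι) (s : ∀ a, X →ₗ[Λᵐᵒᵖ] D.P (k a))
      (t : ∀ a, D.P (k a) →ₗ[Λᵐᵒᵖ] X), ∑ a, t a ∘ₗ s a = LinearMap.id := by
  classical
  cases nonempty_fintype ι
  obtain ⟨α, _, s, t, hst⟩ := D.isGeneratorModule_pi.exists_sum_comp_eq_id (X := X)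
  refine ⟨α × ι, inferInstance, Prod.snd, fun a => LinearMap.proj a.2 ∘ₗ s a.1,
    fun a => t a.1 ∘ₗ LinearMap.single _ _ a.2, ?_⟩
  rw [← hst, Fintype.sum_prod_type]
  refine Finset.sum_congr rfl fun a _ => LinearMap.ext fun x => ?_
  rw [LinearMap.comp_apply, ← Finset.univ_sum_single (s a x), map_sum, LinearMap.sum_apply]
  rfl

end Factorization

theorem arrow_of_ne_zero {i j : ι} {φ : Rad Λᵐᵒᵖ (D.P i) →ₗ[Λᵐᵒᵖ] D.S j} (hφ : φ ≠ 0) :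
    D.Arrow i j := by
  by_contra hall
  have hker := (D.cover i).jacobson_eq_ker
  have : Subsingleton (Abelian.Ext (ModuleCat.of Λᵐᵒᵖ (D.S i)) (ModuleCat.of Λᵐᵒᵖ (D.S j)) 1) :=
    not_nontrivial_iff_subsingleton.1 hall
  obtain ⟨f, hf⟩ := exists_comp_subtype_ker_eq (D.cover i).surjective
    (φ ∘ₗ Submodule.inclusion hker.ge)
  refine hφ (LinearMap.ext fun x => ?_)
  have hfx : f x = φ x := LinearMap.congr_fun hf ⟨x, hker.le x.2⟩
  have hx : f x ∈ Module.jacobson Λᵐᵒᵖ (D.S j) := Module.le_comap_jacobson f x.2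
  rwa [IsSemisimpleModule.jacobson_eq_bot, Submodule.mem_bot, hfx] at hx

theorem arrow_of_radTopHom_ne_zero {i j : ι} {g : D.P j →ₗ[Λᵐᵒᵖ] RadTop Λᵐᵒᵖ (D.P i)}
    (hg : g ≠ 0) : D.Arrow i j := by
  obtain ⟨x, hx⟩ := DFunLike.ne_iff.1 hg
  rw [LinearMap.zero_apply, ne_eq, ← Submodule.mem_bot Λᵐᵒᵖ,
    ← Module.jacobson_quotient_jacobson] at hx
  obtain ⟨W, hW, hxW⟩ := exists_isCoatom_notMem_of_notMem_jacobson hx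
  have := isSimpleModule_iff_isCoatom.2 hW
  obtain ⟨e⟩ := (D.cover j).nonempty_equiv_of_ne_zero (f := W.mkQ ∘ₗ g)
    fun h => hxW ((Submodule.Quotient.mk_eq_zero W).1 (LinearMap.congr_fun h x))
  obtain ⟨y, hy⟩ := Submodule.mkQ_surjective _ (g x)
  refine D.arrow_of_ne_zero (φ := e.toLinearMap ∘ₗ W.mkQ ∘ₗ Submodule.mkQ _) fun h => hxW ?_
  have hey : e (W.mkQ (Submodule.mkQ _ y)) = 0 := LinearMap.congr_fun h y
  rwa [hy, e.map_eq_zero_iff, Submodule.mkQ_apply, Submodule.Quotient.mk_eq_zero] at hey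

theorem ne_of_arrow [Module.Finite K Λ] (hΛ : IsRightHereditary Λ) {i j : ι} (h : D.Arrow i j) :
    i ≠ j := by
  rintro rfl
  exact D.acyclic hΛ i (.single h)

theorem isNoetherian {K : Type u} [Field K] {Λ : Type v} [Ring Λ] [Algebra K Λ]
    [Module.Finite K Λ] {ι : Type w} (D : SimpleSystem K Λ ι) (i : ι) :
    IsNoetherian Λᵐᵒᵖ (D.P i) := by
  have : Module.Finite K Λᵐᵒᵖ := Module.Finite.equiv (MulOpposite.opLinearEquiv K)
  have := (D.cover i).finite K
  exact isNoetherian_of_tower K inferInstance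

/-- A homomorphism between two different indecomposable projectives, with values in the radical. -/
def toRad {K : Type u} [Field K] {Λ : Type v} [Ring Λ] [Algebra K Λ] {ι : Type w}
    (D : SimpleSystem K Λ ι) {i j : ι} (hij : i ≠ j) (f : D.P j →ₗ[Λᵐᵒᵖ] D.P i) :
    RadHom Λᵐᵒᵖ (D.P i) (D.P j) :=
  f.codRestrict _ (D.mem_jacobson_of_ne hij f)

section RadicalDecomposition

variable {K : Type u} [Field K] {Λ : Type v} [Ring Λ] [Algebra K Λ] {ι : Type w}
  (D : SimpleSystem K Λ ι) {i : ι} {B : Type*} [Fintype B] [DecidableEq B] {j : B → ι}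
  {s : ∀ b, D.P (j b) →ₗ[Λᵐᵒᵖ] Rad Λᵐᵒᵖ (D.P i)}

theorem lsum_surjective [Module.Finite Λᵐᵒᵖ (Rad Λᵐᵒᵖ (D.P i))]
    (hgen : ∀ k (g : D.P k →ₗ[Λᵐᵒᵖ] RadTop Λᵐᵒᵖ (D.P i)),
      LinearMap.range g ≤ ⨆ b, LinearMap.range (Submodule.mkQ _ ∘ₗ s b)) :
    Function.Surjective (LinearMap.lsum Λᵐᵒᵖ (fun b => D.P (j b)) ℕ s) := by
  refine LinearMap.range_eq_top.1 ((eq_top_or_exists_le_coatom _).resolve_right ?_)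
  rintro ⟨W, hW, hle⟩
  obtain ⟨k, f, hf⟩ := D.exists_mkQ_comp_ne_zero hW
  have hsW : ⨆ b, LinearMap.range ((Module.jacobson Λᵐᵒᵖ (Rad Λᵐᵒᵖ (D.P i))).mkQ ∘ₗ s b) ≤
      W.map (Submodule.mkQ _) := by
    refine iSup_le fun b => ?_
    rw [LinearMap.range_comp]
    refine Submodule.map_mono (le_trans ?_ hle)
    rintro _ ⟨x, rfl⟩
    exact ⟨Pi.single b x, LinearMap.lsum_piSingle ..⟩
  have hJW : Module.jacobson Λᵐᵒᵖ (Rad Λᵐᵒᵖ (D.P i)) ≤ W := sInf_le hW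
  refine hf (LinearMap.ext fun x => (Submodule.Quotient.mk_eq_zero W).2 ?_)
  have hx := hsW (hgen k (Submodule.mkQ _ ∘ₗ f) ⟨x, rfl⟩)
  rwa [LinearMap.comp_apply, ← Submodule.mem_comap, Submodule.comap_map_mkQ,
    sup_eq_right.2 hJW] at hx

theorem ker_lsum_le_jacobson
    (hind : ∀ k (c : ∀ b, D.P k →ₗ[Λᵐᵒᵖ] D.P (j b)),
      ∑ b, (Submodule.mkQ _ ∘ₗ s b) ∘ₗ c b = (0 : D.P k →ₗ[Λᵐᵒᵖ] RadTop Λᵐᵒᵖ (D.P i)) →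
        ∀ b, j b = k → c b = 0) :
    LinearMap.ker (LinearMap.lsum Λᵐᵒᵖ (fun b => D.P (j b)) ℕ s) ≤
      Module.jacobson Λᵐᵒᵖ (∀ b, D.P (j b)) := by
  intro x hx
  suffices hcomp : ∀ b, x b ∈ Module.jacobson Λᵐᵒᵖ (D.P (j b)) by
    rw [← Finset.univ_sum_single x]
    exact Submodule.sum_mem _ fun b _ =>
      Module.le_comap_jacobson (LinearMap.single Λᵐᵒᵖ (fun b => D.P (j b)) b) (hcomp b)
  intro b
  rw [(D.cover (j b)).jacobson_eq_ker]
  by_contra hb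
  let N := LinearMap.ker (LinearMap.lsum Λᵐᵒᵖ (fun b => D.P (j b)) ℕ s)
  have := (D.cover (j b)).projective
  have hsurj : Function.Surjective (D.π (j b) ∘ₗ LinearMap.proj b ∘ₗ N.subtype) :=
    LinearMap.surjective_of_ne_zero fun h => hb (LinearMap.congr_fun h ⟨x, hx⟩)
  obtain ⟨c, hc⟩ := Module.projective_lifting_property _ (D.π (j b)) hsurj
  have hcb : LinearMap.proj b ∘ₗ N.subtype ∘ₗ c = 0 := by
    refine hind (j b) (fun d => LinearMap.proj d ∘ₗ N.subtype ∘ₗ c)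
      (LinearMap.ext fun y => ?_) b rfl
    have hy := congrArg (Submodule.mkQ (Module.jacobson Λᵐᵒᵖ (Rad Λᵐᵒᵖ (D.P i)))) (c y).2
    simpa using hy
  exact (D.cover (j b)).ne_zero (by rw [← hc, LinearMap.comp_assoc, LinearMap.comp_assoc, hcb,
    LinearMap.comp_zero])

theorem lsum_bijective [Module.Finite K Λ] (hΛ : IsRightHereditary Λ)
    (hgen : ∀ k (g : D.P k →ₗ[Λᵐᵒᵖ] RadTop Λᵐᵒᵖ (D.P i)),
      LinearMap.range g ≤ ⨆ b, LinearMap.range (Submodule.mkQ _ ∘ₗ s b))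
    (hind : ∀ k (c : ∀ b, D.P k →ₗ[Λᵐᵒᵖ] D.P (j b)),
      ∑ b, (Submodule.mkQ _ ∘ₗ s b) ∘ₗ c b = (0 : D.P k →ₗ[Λᵐᵒᵖ] RadTop Λᵐᵒᵖ (D.P i)) →
        ∀ b, j b = k → c b = 0) :
    Function.Bijective (LinearMap.lsum Λᵐᵒᵖ (fun b => D.P (j b)) ℕ s) := by
  have : Module.Finite K Λᵐᵒᵖ := Module.Finite.equiv (MulOpposite.opLinearEquiv K)
  have := D.isNoetherian i
  have (b : B) := D.isNoetherian (j b)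
  have := (D.cover i).projective_submodule hΛ (Module.jacobson Λᵐᵒᵖ (D.P i))
  have hs := D.lsum_surjective hgen
  exact ⟨injective_of_ker_le_jacobson hs (D.ker_lsum_le_jacobson hind), hs⟩

theorem sum_subtype_comp_bijective
    (hs : Function.Bijective (LinearMap.lsum Λᵐᵒᵖ (fun b => D.P (j b)) ℕ s)) {k : ι}
    (hik : i ≠ k) :
    Function.Bijective fun c : ∀ b, D.P k →ₗ[Λᵐᵒᵖ] D.P (j b) =>
      ∑ b, ((Module.jacobson Λᵐᵒᵖ (D.P i)).subtype ∘ₗ s b) ∘ₗ c b := by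
  have hsum (c : ∀ b, D.P k →ₗ[Λᵐᵒᵖ] D.P (j b)) :
      ∑ b, ((Module.jacobson Λᵐᵒᵖ (D.P i)).subtype ∘ₗ s b) ∘ₗ c b =
        (Module.jacobson Λᵐᵒᵖ (D.P i)).subtype ∘ₗ LinearMap.lsum Λᵐᵒᵖ _ ℕ s ∘ₗ
          LinearMap.pi c := by
    ext x
    simp
  simp only [hsum]
  refine ⟨fun c c' h => funext fun b => ?_, fun f => ?_⟩
  · rw [LinearMap.cancel_left Subtype.val_injective, LinearMap.cancel_left hs.1] at h
    simpa using congrArg (LinearMap.proj b ∘ₗ ·) h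
  · have := (D.cover k).projective
    obtain ⟨c, hc⟩ := Module.projective_lifting_property _ (D.toRad hik f) hs.2
    refine ⟨fun b => LinearMap.proj b ∘ₗ c, ?_⟩
    exact congrArg ((Module.jacobson Λᵐᵒᵖ (D.P i)).subtype ∘ₗ ·) hc

end RadicalDecomposition

section Basis

variable {K : Type u} [Field K] {Λ : Type v} [Ring Λ] [Algebra K Λ] {ι : Type w}
  (D : SimpleSystem K Λ ι)

theorem exists_basis_radTopHom [Module.Finite K Λ] (hΛ : IsRightHereditary Λ) (i j : ι) :
    ∃ (β : Type v) (_ : Fintype β), Nonempty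
      (Module.Basis β (Module.End Λᵐᵒᵖ (D.P j))ᵐᵒᵖ (RadTopHom Λᵐᵒᵖ (D.P i) (D.P j))) := by
  have : Module.Finite K Λᵐᵒᵖ := Module.Finite.equiv (MulOpposite.opLinearEquiv K)
  have := (D.cover i).finite K
  have := (D.cover j).finite K
  have : Module.Finite K (RadTopHom Λᵐᵒᵖ (D.P i) (D.P j)) := RadTopHom.finite
  let := D.divisionRing hΛ j
  have : Module.Finite (Module.End Λᵐᵒᵖ (D.P j))ᵐᵒᵖ (RadTopHom Λᵐᵒᵖ (D.P i) (D.P j)) :=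
    Module.Finite.of_restrictScalars_finite K _ _
  have : Module.Free (Module.End Λᵐᵒᵖ (D.P j))ᵐᵒᵖ (RadTopHom Λᵐᵒᵖ (D.P i) (D.P j)) :=
    Module.Free.of_divisionRing _ _
  exact ⟨_, inferInstance, ⟨Module.Free.chooseBasis _ _⟩⟩

theorem arrow_of_basis {i j : ι} {β : Type*}
    (m : Module.Basis β (Module.End Λᵐᵒᵖ (D.P j))ᵐᵒᵖ (RadTopHom Λᵐᵒᵖ (D.P i) (D.P j))) (l : β) :
    D.Arrow i j :=
  have := (D.cover j).nontrivial
  D.arrow_of_radTopHom_ne_zero (m.ne_zero l)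

variable {i : ι} {β : ι → Type v} (m : ∀ j,
  Module.Basis (β j) (Module.End Λᵐᵒᵖ (D.P j))ᵐᵒᵖ (RadTopHom Λᵐᵒᵖ (D.P i) (D.P j)))

theorem range_le_iSup_range_basis [∀ j, Finite (β j)] {k : ι} (g : RadTopHom Λᵐᵒᵖ (D.P i) (D.P k)) :
    LinearMap.range g ≤ ⨆ b : Σ j, β j, LinearMap.range (m b.1 b.2) := by
  rintro _ ⟨x, rfl⟩
  cases nonempty_fintype (β k)
  have hg : g = ∑ l, (m k l : D.P k →ₗ[Λᵐᵒᵖ] RadTop Λᵐᵒᵖ (D.P i)) ∘ₗ ((m k).repr g l).unop :=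
    ((m k).sum_repr g).symm
  rw [LinearMap.congr_fun hg x, LinearMap.sum_apply]
  exact Submodule.sum_mem _ fun l _ => Submodule.mem_iSup_of_mem ⟨k, l⟩ ⟨_, rfl⟩

theorem eq_zero_of_sum_basis_comp_eq_zero [Fintype ι] [∀ j, Fintype (β j)] {k : ι}
    {c : ∀ b : Σ j, β j, D.P k →ₗ[Λᵐᵒᵖ] D.P b.1}
    (hc : ∑ b : Σ j, β j, m b.1 b.2 ∘ₗ c b = 0) (l : β k) : c ⟨k, l⟩ = 0 := by
  have hk : ∑ l, (m k l : D.P k →ₗ[Λᵐᵒᵖ] RadTop Λᵐᵒᵖ (D.P i)) ∘ₗ c ⟨k, l⟩ = 0 := by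
    refine (Fintype.sum_eq_single k fun j hj => ?_).symm.trans
      ((Fintype.sum_sigma _).symm.trans hc)
    exact Finset.sum_eq_zero fun l _ => D.comp_eq_zero_of_ne hj _ _
  exact MulOpposite.op_injective (Fintype.linearIndependent_iff.1 (m k).linearIndependent
    (fun l => MulOpposite.op (c ⟨k, l⟩)) hk l)

end Basis

end SimpleSystem

/-! ## Realizations of modulated quivers -/

namespace ModulatedQuiver

variable {K : Type u} [Field K] (Q : ModulatedQuiver.{u, v, w} K)

/-- The element of the path sum given by an element of an arrow bimodule. -/
noncomputable def arrowElt {i j : Q.V} (a : i ⟶ j) : Q.bimodule a →ₗ[K] Q.PathSum i j :=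
  (Q.incl (Quiver.Path.nil.cons a)).comp ((Q.consEquiv .nil a).toLinearMap.comp
    (BalancedTensor.mk K (Q.F i) (Q.TensorPath .nil) (Q.bimodule a) (Q.nilEquiv i 1)))

theorem arrowElt_eq {i j : Q.V} (a : i ⟶ j) (m : Q.bimodule a) :
    Q.arrowElt a m = Q.incl (Quiver.Path.nil.cons a) (Q.snoc (Q.nilEquiv i 1) a m) := rfl

theorem incl_snoc {i j k : Q.V} (p : Quiver.Path i j) (t : Q.TensorPath p) (a : j ⟶ k)
    (m : Q.bimodule a) :
    Q.incl (p.cons a) (Q.snoc t a m) = Q.comp i j k (Q.incl p t) (Q.arrowElt a m) := by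
  rw [arrowElt_eq, comp_incl, concat_snoc, concat_nil, MulOpposite.op_one, one_smul]
  rfl

theorem arrowElt_left_smul {i j : Q.V} (a : i ⟶ j) (f : Q.F i) (m : Q.bimodule a) :
    Q.arrowElt a (f • m) = Q.comp i i j (Q.incl .nil (Q.nilEquiv i f)) (Q.arrowElt a m) := by
  rw [← incl_snoc, arrowElt_eq]
  refine congrArg (Q.incl (Quiver.Path.nil.cons a)) ?_
  refine congrArg (Q.consEquiv .nil a) ?_
  rw [← BalancedTensor.smul_tmul, smul_nilEquiv, MulOpposite.unop_op, one_mul]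

theorem arrowElt_right_smul {i j : Q.V} (a : i ⟶ j) (g : Q.F j) (m : Q.bimodule a) :
    Q.arrowElt a (MulOpposite.op g • m) =
      Q.comp i j j (Q.arrowElt a m) (Q.incl .nil (Q.nilEquiv j g)) := by
  rw [arrowElt_eq, arrowElt_eq, comp_incl, concat_nil]
  refine congrArg (Q.incl (Quiver.Path.nil.cons a)) ?_
  exact congrArg (Q.consEquiv .nil a) (BalancedTensor.right_smul_tmul (K := K) (F := Q.F i)
    (MulOpposite.op g) (Q.nilEquiv i 1) m).symm

theorem mem_of_incl_mem {i j : Q.V} {S : Submodule K (Q.PathSum i j)}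
    (h : ∀ p t, Q.incl p t ∈ S) (x : Q.PathSum i j) : x ∈ S := by
  have : S.mkQ = 0 := Q.pathSum_hom_ext fun p t =>
    (Submodule.Quotient.mk_eq_zero S).2 (h p t)
  exact (Submodule.Quotient.mk_eq_zero S).1 (LinearMap.congr_fun this x)

theorem incl_cons_mem {i j k : Q.V} {S : Submodule K (Q.PathSum i k)} {p : Quiver.Path i j}
    {a : j ⟶ k} (h : ∀ t m, Q.incl (p.cons a) (Q.snoc t a m) ∈ S) (x : Q.TensorPath (p.cons a)) :
    Q.incl (p.cons a) x ∈ S := by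
  have : S.mkQ.comp (Q.incl (p.cons a)) = 0 := Q.tensorPath_cons_ext fun t m =>
    (Submodule.Quotient.mk_eq_zero S).2 (h t m)
  exact (Submodule.Quotient.mk_eq_zero S).1 (LinearMap.congr_fun this x)

theorem transGen_of_path {i j : Q.V} (p : Quiver.Path i j) (hp : p.length ≠ 0) :
    Relation.TransGen Q.Arrow i j := by
  induction p with
  | nil => exact absurd rfl hp
  | cons p a ih =>
    cases p with
    | nil => exact .single a.down
    | cons p b => exact (ih (Nat.succ_ne_zero _)).tail a.down

theorem length_eq_zero_of_cycle {i : Q.V} (p : Quiver.Path i i) : p.length = 0 := by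
  by_contra h
  exact Q.acyclic i (Q.transGen_of_path p h)

theorem exists_incl_nil_eq {i : Q.V} (x : Q.PathSum i i) :
    ∃ f : Q.F i, x = Q.incl .nil (Q.nilEquiv i f) := by
  suffices x ∈ LinearMap.range ((Q.incl (.nil : Quiver.Path i i)).comp
      (Q.nilEquiv i).toLinearMap) by
    obtain ⟨f, hf⟩ := this
    exact ⟨f, hf.symm⟩
  refine Q.mem_of_incl_mem (fun p t => ?_) x
  obtain rfl : p = .nil := Quiver.Path.eq_nil_of_length_zero p (Q.length_eq_zero_of_cycle p)
  exact ⟨(Q.nilEquiv i).symm t, congrArg _ ((Q.nilEquiv i).apply_symm_apply t)⟩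

section RightSpan

variable {Q} {B : Type*} {i : Q.V} {t : B → Q.V} (a : ∀ b, i ⟶ t b) (m : ∀ b, Q.bimodule (a b))

/-- The part of a path sum generated on the right by the elements `m b` of the arrow bimodules. -/
noncomputable def rightSpan (k : Q.V) : Submodule K (Q.PathSum i k) :=
  ⨆ b, LinearMap.range (Q.comp i (t b) k (Q.arrowElt (a b) (m b)))

variable {a m}

theorem arrowElt_mem_rightSpan (b : B) : Q.arrowElt (a b) (m b) ∈ rightSpan a m (t b) :=
  Submodule.mem_iSup_of_mem b ⟨Q.idPath (t b), Q.comp_id _⟩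

theorem comp_mem_rightSpan {j k : Q.V} {x : Q.PathSum i j} (hx : x ∈ rightSpan a m j)
    (z : Q.PathSum j k) : Q.comp i j k x z ∈ rightSpan a m k := by
  suffices rightSpan a m j ≤ (rightSpan a m k).comap ((Q.comp i j k).flip z) from this hx
  refine iSup_le fun b => ?_
  rintro _ ⟨y, rfl⟩
  rw [Submodule.mem_comap, LinearMap.flip_apply, comp_assoc]
  exact Submodule.mem_iSup_of_mem b ⟨_, rfl⟩

theorem arrowElt_mem_rightSpan_of_mem_span {j : Q.V} {c : i ⟶ j} {X : Set (Q.bimodule c)}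
    (hX : ∀ x ∈ X, Q.arrowElt c x ∈ rightSpan a m j) {x : Q.bimodule c}
    (hx : x ∈ Submodule.span (Q.F j)ᵐᵒᵖ X) : Q.arrowElt c x ∈ rightSpan a m j := by
  induction hx using Submodule.span_induction with
  | mem x hx => exact hX x hx
  | zero => rw [map_zero]; exact Submodule.zero_mem _
  | add x y _ _ hx hy => rw [map_add]; exact Submodule.add_mem _ hx hy
  | smul g x _ hx =>
    rw [← MulOpposite.op_unop g, arrowElt_right_smul]
    exact comp_mem_rightSpan hx _

theorem incl_mem_rightSpan
    (h : ∀ {j : Q.V} (c : i ⟶ j) (x : Q.bimodule c), Q.arrowElt c x ∈ rightSpan a m j)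
    {k : Q.V} (p : Quiver.Path i k) (hp : p.length ≠ 0) (x : Q.TensorPath p) :
    Q.incl p x ∈ rightSpan a m k := by
  induction p with
  | nil => exact absurd rfl hp
  | cons p c ih =>
    refine Q.incl_cons_mem (fun x y => ?_) x
    rw [incl_snoc]
    cases p with
    | nil =>
      obtain ⟨f, rfl⟩ := (Q.nilEquiv i).surjective x
      rw [← arrowElt_left_smul]
      exact h c _
    | cons p d => exact comp_mem_rightSpan (ih (Nat.succ_ne_zero _) x) _

theorem rightSpan_eq_top_of_ne
    (h : ∀ {j : Q.V} (c : i ⟶ j) (x : Q.bimodule c), Q.arrowElt c x ∈ rightSpan a m j)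
    {k : Q.V} (hik : i ≠ k) : rightSpan a m k = ⊤ :=
  eq_top_iff.2 fun x _ => Q.mem_of_incl_mem (fun p y => incl_mem_rightSpan h p
    (fun hp => hik (Quiver.Path.eq_of_length_zero p hp)) y) x

end RightSpan

/-- A realization of a modulated quiver by modules `P i` over an algebra `A`: the algebra `F i`
acts on `P i`, and the bimodule `M i j` acts by homomorphisms `P j → P i`. -/
structure Realization (A : Type v) [Ring A] [Algebra K A] (P : Q.V → Type v)
    [∀ i, AddCommGroup (P i)] [∀ i, Module A (P i)] [∀ i, Module K (P i)]
    [∀ i, IsScalarTower K A (P i)] where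
  vertex : ∀ i, Q.F i →ₐ[K] Module.End A (P i)
  arrow : ∀ {i j : Q.V} (a : i ⟶ j), Q.bimodule a →ₗ[K] (P j →ₗ[A] P i)
  arrow_left_smul : ∀ {i j : Q.V} (a : i ⟶ j) (f : Q.F i) (m : Q.bimodule a),
    arrow a (f • m) = (vertex i f).comp (arrow a m)
  arrow_right_smul : ∀ {i j : Q.V} (a : i ⟶ j) (g : Q.F j) (m : Q.bimodule a),
    arrow a (MulOpposite.op g • m) = (arrow a m).comp (vertex j g)

namespace Realization

variable {Q} {A : Type v} [Ring A] [Algebra K A] {P : Q.V → Type v}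
    [∀ i, AddCommGroup (P i)] [∀ i, Module A (P i)] [∀ i, Module K (P i)]
    [∀ i, IsScalarTower K A (P i)] (ρ : Q.Realization A P)

/-- Composition of homomorphisms as a bilinear map. -/
def compₗ (i j k : Q.V) : (P j →ₗ[A] P i) →ₗ[K] (P k →ₗ[A] P j) →ₗ[K] (P k →ₗ[A] P i) :=
  LinearMap.mk₂ K (fun f g => f.comp g) (fun _ _ _ => rfl) (fun _ _ _ => rfl)
    (fun f g h => LinearMap.comp_add g h f)
    (fun c f g => LinearMap.ext fun x => (f.restrictScalars K).map_smul c (g x))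

theorem extendPath_balanced {i j k : Q.V} {p : Quiver.Path i j}
    (c : Q.TensorPath p →ₗ[K] (P j →ₗ[A] P i))
    (hc : ∀ x (g : (Q.F j)ᵐᵒᵖ), c (g • x) = (c x).comp (ρ.vertex j g.unop)) (a : j ⟶ k)
    (x : Q.TensorPath p) (f : Q.F j) (m : Q.bimodule a) :
    (((compₗ i j k).comp c).compl₂ (ρ.arrow a)) (MulOpposite.op f • x) m =
      (((compₗ i j k).comp c).compl₂ (ρ.arrow a)) x (f • m) := by
  change (c (MulOpposite.op f • x)).comp (ρ.arrow a m) = (c x).comp (ρ.arrow a (f • m))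
  rw [hc, ρ.arrow_left_smul]
  rfl

/-- The action of a tensor path that ends in the arrow `a`. -/
noncomputable def extendPath {i j k : Q.V} {p : Quiver.Path i j}
    (c : Q.TensorPath p →ₗ[K] (P j →ₗ[A] P i))
    (hc : ∀ x (g : (Q.F j)ᵐᵒᵖ), c (g • x) = (c x).comp (ρ.vertex j g.unop)) (a : j ⟶ k) :
    Q.TensorPath (p.cons a) →ₗ[K] (P k →ₗ[A] P i) :=
  (BalancedTensor.lift (((compₗ i j k).comp c).compl₂ (ρ.arrow a))
    (ρ.extendPath_balanced c hc a)).comp (Q.consEquiv p a).symm.toLinearMap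

theorem extendPath_snoc {i j k : Q.V} {p : Quiver.Path i j}
    (c : Q.TensorPath p →ₗ[K] (P j →ₗ[A] P i))
    (hc : ∀ x (g : (Q.F j)ᵐᵒᵖ), c (g • x) = (c x).comp (ρ.vertex j g.unop)) (a : j ⟶ k)
    (t : Q.TensorPath p) (m : Q.bimodule a) :
    ρ.extendPath c hc a (Q.snoc t a m) = (c t).comp (ρ.arrow a m) :=
  BalancedTensor.lift_tmul (((compₗ i j k).comp c).compl₂ (ρ.arrow a))
    (ρ.extendPath_balanced c hc a) t m

theorem extendPath_smul {i j k : Q.V} {p : Quiver.Path i j}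
    (c : Q.TensorPath p →ₗ[K] (P j →ₗ[A] P i))
    (hc : ∀ x (g : (Q.F j)ᵐᵒᵖ), c (g • x) = (c x).comp (ρ.vertex j g.unop)) (a : j ⟶ k)
    (x : Q.TensorPath (p.cons a)) (g : (Q.F k)ᵐᵒᵖ) :
    ρ.extendPath c hc a (g • x) = (ρ.extendPath c hc a x).comp (ρ.vertex k g.unop) := by
  refine LinearMap.congr_fun (Q.tensorPath_cons_ext
    (g := (ρ.extendPath c hc a).comp (Module.toModuleEnd K (S := (Q.F k)ᵐᵒᵖ) _ g))
    (h := ((compₗ i k k).flip (ρ.vertex k g.unop)).comp (ρ.extendPath c hc a)) fun t m => ?_) x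
  have hsnoc : g • Q.snoc t a m = Q.snoc t a (g • m) :=
    congrArg (Q.consEquiv p a) (BalancedTensor.right_smul_tmul g t m)
  change ρ.extendPath c hc a (g • Q.snoc t a m) =
    (ρ.extendPath c hc a (Q.snoc t a m)).comp (ρ.vertex k g.unop)
  rw [hsnoc, extendPath_snoc, extendPath_snoc, ← MulOpposite.op_unop g, ρ.arrow_right_smul]
  rfl

/-- The action of a tensor path by a homomorphism. -/
noncomputable def evalPath {i : Q.V} : ∀ {j : Q.V} (p : Quiver.Path i j),
    { c : Q.TensorPath p →ₗ[K] (P j →ₗ[A] P i) //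
      ∀ x (g : (Q.F j)ᵐᵒᵖ), c (g • x) = (c x).comp (ρ.vertex j g.unop) }
  | _, .nil => ⟨(ρ.vertex i).toLinearMap.comp (Q.nilEquiv i).symm.toLinearMap, fun x g => by
      obtain ⟨f, rfl⟩ := (Q.nilEquiv i).surjective x
      exact map_mul (ρ.vertex i) f g.unop⟩
  | _, .cons p a => ⟨ρ.extendPath (evalPath p).1 (evalPath p).2 a,
      ρ.extendPath_smul (evalPath p).1 (evalPath p).2 a⟩

theorem evalPath_nil (i : Q.V) (f : Q.F i) :
    (ρ.evalPath (.nil : Quiver.Path i i)).1 (Q.nilEquiv i f) = ρ.vertex i f := rfl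

theorem evalPath_snoc {i j k : Q.V} (p : Quiver.Path i j) (t : Q.TensorPath p) (a : j ⟶ k)
    (m : Q.bimodule a) :
    (ρ.evalPath (p.cons a)).1 (Q.snoc t a m) = ((ρ.evalPath p).1 t).comp (ρ.arrow a m) :=
  ρ.extendPath_snoc (ρ.evalPath p).1 (ρ.evalPath p).2 a t m

theorem evalPath_concat {i j k : Q.V} (p : Quiver.Path i j) (q : Quiver.Path j k)
    (x : Q.TensorPath p) (y : Q.TensorPath q) : (ρ.evalPath (p.comp q)).1 (Q.concat p q x y) =
      ((ρ.evalPath p).1 x).comp ((ρ.evalPath q).1 y) := by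
  induction q with
  | nil =>
    obtain ⟨f, rfl⟩ := (Q.nilEquiv j).surjective y
    rw [concat_nil]
    exact (ρ.evalPath p).2 x (MulOpposite.op f)
  | cons q a ih =>
    refine LinearMap.congr_fun (Q.tensorPath_cons_ext
      (g := (ρ.evalPath (p.comp (q.cons a))).1.comp (Q.concat p (q.cons a) x))
      (h := (compₗ i j _ ((ρ.evalPath p).1 x)).comp (ρ.evalPath (q.cons a)).1) fun t m => ?_) y
    rw [LinearMap.comp_apply, LinearMap.comp_apply, concat_snoc, evalPath_snoc]
    refine (ρ.evalPath_snoc (p.comp q) _ a m).trans ?_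
    rw [ih]
    rfl

open Classical in
/-- The action of a path sum by homomorphisms. -/
noncomputable def eval (i j : Q.V) : Q.PathSum i j →ₗ[K] (P j →ₗ[A] P i) :=
  DirectSum.toModule K _ _ (fun p => (ρ.evalPath p).1)

theorem eval_incl {i j : Q.V} (p : Quiver.Path i j) (x : Q.TensorPath p) :
    ρ.eval i j (Q.incl p x) = (ρ.evalPath p).1 x := by
  simp [eval, incl]

theorem eval_comp {i j k : Q.V} (x : Q.PathSum i j) (y : Q.PathSum j k) :
    ρ.eval i k (Q.comp i j k x y) = (ρ.eval i j x).comp (ρ.eval j k y) := by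
  have hincl : ∀ p (x : Q.TensorPath p), (ρ.eval i k).comp (Q.comp i j k (Q.incl p x)) =
      (compₗ i j k ((ρ.evalPath p).1 x)).comp (ρ.eval j k) := fun p x =>
    Q.pathSum_hom_ext fun q y => by
      rw [LinearMap.comp_apply, LinearMap.comp_apply, comp_incl, eval_incl, eval_incl,
        evalPath_concat]
      rfl
  have : (ρ.eval i k).comp ((Q.comp i j k).flip y) =
      ((compₗ i j k).flip (ρ.eval j k y)).comp (ρ.eval i j) :=
    Q.pathSum_hom_ext fun p x => by
      rw [LinearMap.comp_apply, LinearMap.comp_apply, eval_incl]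
      exact LinearMap.congr_fun (hincl p x) y
  exact LinearMap.congr_fun this x

theorem eval_arrowElt {i j : Q.V} (a : i ⟶ j) (m : Q.bimodule a) :
    ρ.eval i j (Q.arrowElt a m) = ρ.arrow a m := by
  rw [arrowElt_eq, eval_incl, evalPath_snoc, evalPath_nil, map_one]
  rfl

theorem eval_idPath (i : Q.V) : ρ.eval i i (Q.idPath i) = LinearMap.id := by
  rw [idPath, eval_incl, evalPath_nil, map_one]
  rfl

theorem eval_self_bijective {i : Q.V} (hi : Function.Bijective (ρ.vertex i)) :
    Function.Bijective (ρ.eval i i) := by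
  have hnil (f : Q.F i) : ρ.eval i i (Q.incl .nil (Q.nilEquiv i f)) = ρ.vertex i f := by
    rw [eval_incl, evalPath_nil]
  constructor
  · intro x y hxy
    obtain ⟨f, rfl⟩ := Q.exists_incl_nil_eq x
    obtain ⟨g, rfl⟩ := Q.exists_incl_nil_eq y
    rw [hnil, hnil] at hxy
    rw [hi.1 hxy]
  · intro f
    obtain ⟨g, rfl⟩ := hi.2 f
    exact ⟨_, hnil g⟩

theorem eval_bijective_of_ne {B : Type*} [Fintype B] {i : Q.V} {t : B → Q.V} {a : ∀ b, i ⟶ t b}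
    {m : ∀ b, Q.bimodule (a b)}
    (hgen : ∀ {j : Q.V} (c : i ⟶ j) (x : Q.bimodule c), Q.arrowElt c x ∈ rightSpan a m j)
    {k : Q.V} (hik : i ≠ k)
    (hcomp : Function.Bijective fun f : ∀ b, P k →ₗ[A] P (t b) => ∑ b, ρ.arrow (a b) (m b) ∘ₗ f b)
    (heval : ∀ b, Function.Bijective (ρ.eval (t b) k)) : Function.Bijective (ρ.eval i k) := by
  classical
  let L : (∀ b, Q.PathSum (t b) k) →ₗ[K] Q.PathSum i k :=
    LinearMap.lsum K _ ℕ fun b => Q.comp i (t b) k (Q.arrowElt (a b) (m b))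
  have hL : Function.Surjective L := by
    rw [← LinearMap.range_eq_top, ← top_le_iff, ← rightSpan_eq_top_of_ne hgen hik]
    refine iSup_le fun b => ?_
    rintro _ ⟨y, rfl⟩
    exact ⟨Pi.single b y, LinearMap.lsum_piSingle ..⟩
  have hevalL : ρ.eval i k ∘ L =
      (fun f : ∀ b, P k →ₗ[A] P (t b) => ∑ b, ρ.arrow (a b) (m b) ∘ₗ f b) ∘
        Pi.map fun b => ρ.eval (t b) k := by
    funext y
    simp [L, eval_comp, eval_arrowElt]
  have hbij : Function.Bijective (ρ.eval i k ∘ L) :=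
    hevalL ▸ hcomp.comp (Function.Bijective.piMap heval)
  exact ⟨hbij.1.of_comp_right hL, hbij.2.of_comp⟩

/-- The action of the tensor algebra on the product of the modules `P i`. -/
noncomputable def toEndₗ : Q.TensorAlgebra →ₗ[K] Module.End A (∀ i, P i) where
  toFun x := LinearMap.pi fun i => ∑ j, (ρ.eval i j (x i j)).comp (LinearMap.proj j)
  map_add' x y := LinearMap.ext fun p => funext fun i => by
    simp [TensorAlgebra.add_apply, Finset.sum_add_distrib]
  map_smul' c x := LinearMap.ext fun p => funext fun i => by
    simp [TensorAlgebra.smul_apply, Finset.smul_sum]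

theorem toEndₗ_apply (x : Q.TensorAlgebra) (p : ∀ i, P i) (i : Q.V) :
    ρ.toEndₗ x p i = ∑ j, ρ.eval i j (x i j) (p j) := by
  simp [toEndₗ]

/-- The action of the tensor algebra on the product of the modules `P i`, as a homomorphism of
algebras. -/
noncomputable def toEnd : Q.TensorAlgebra →ₐ[K] Module.End A (∀ i, P i) :=
  AlgHom.ofLinearMap ρ.toEndₗ
    (LinearMap.ext fun p => funext fun i => by
      rw [toEndₗ_apply, Finset.sum_eq_single i]
      · rw [TensorAlgebra.one_apply_same, eval_idPath]; rfl
      · intro j _ hj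
        rw [TensorAlgebra.one_apply_ne hj.symm, map_zero]; rfl
      · exact fun h => absurd (Finset.mem_univ i) h)
    (fun x y => LinearMap.ext fun p => funext fun i => by
      rw [toEndₗ_apply, Module.End.mul_apply, toEndₗ_apply]
      simp only [TensorAlgebra.mul_apply, toEndₗ_apply, map_sum, LinearMap.sum_apply, eval_comp]
      exact Finset.sum_comm)

theorem toEnd_bijective (h : ∀ i j, Function.Bijective (ρ.eval i j)) :
    Function.Bijective ρ.toEnd := by
  classical
  have key : ∀ x i j (y : P j), ρ.toEnd x (Pi.single j y) i = ρ.eval i j (x i j) y := by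
    intro x i j y
    refine (ρ.toEndₗ_apply x _ i).trans ?_
    rw [Finset.sum_eq_single j]
    · rw [Pi.single_eq_same]
    · intro k _ hk
      rw [Pi.single_eq_of_ne hk, map_zero]
    · exact fun h => absurd (Finset.mem_univ j) h
  constructor
  · intro x y hxy
    refine TensorAlgebra.ext fun i j => (h i j).1 (LinearMap.ext fun z => ?_)
    rw [← key, hxy, key]
  · intro f
    choose x hx using fun i j => (h i j).2
      ((LinearMap.proj i).comp (f.comp (LinearMap.single A P j)))
    refine ⟨x, LinearMap.pi_ext fun j y => funext fun i => ?_⟩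
    refine (key x i j y).trans ?_
    rw [hx]
    rfl

end Realization

end ModulatedQuiver

/-! ## Radical bimodules with sections -/

namespace SimpleSystem

section HasSection

variable {K : Type u} [Field K] {Λ : Type v} [Ring Λ] [Algebra K Λ] {ι : Type w}
  (D : SimpleSystem K Λ ι)

/-- The bimodule homomorphisms `Hom(P j, rP i / r²P i) → Hom(P j, rP i)`, among which one looks for
sections of the projection. -/
abbrev TopRadHom (i j : ι) : Type v :=
  BimoduleHom (Module.End Λᵐᵒᵖ (D.P i)) (Module.End Λᵐᵒᵖ (D.P j))
    (RadTopHom Λᵐᵒᵖ (D.P i) (D.P j)) (RadHom Λᵐᵒᵖ (D.P i) (D.P j))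

/-- A homomorphism `Hom(P j, rP i / r²P i) → Hom(P j, rP i)`, with its values regarded as
homomorphisms `P j → P i`. -/
noncomputable def sectionMap {i j : ι} (σ : D.TopRadHom i j) :
    RadTopHom Λᵐᵒᵖ (D.P i) (D.P j) →ₗ[K] (D.P j →ₗ[Λᵐᵒᵖ] D.P i) where
  toFun m := (Module.jacobson Λᵐᵒᵖ (D.P i)).subtype ∘ₗ (σ.toAddMonoidHom m : D.P j →ₗ[Λᵐᵒᵖ] _)
  map_add' m m' := by
    rw [map_add]
    exact LinearMap.comp_add _ _ _
  map_smul' c m := by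
    have hc : c • m = (c • (1 : Module.End Λᵐᵒᵖ (D.P i))) • m := by rw [smul_assoc, one_smul]
    rw [hc]
    exact congrArg (fun φ : D.P j →ₗ[Λᵐᵒᵖ] Rad Λᵐᵒᵖ (D.P i) =>
      (Module.jacobson Λᵐᵒᵖ (D.P i)).subtype ∘ₗ φ) (σ.map_left_smul (c • 1) m)

variable [Module.Finite K Λ] [Fintype ι]

section Basis

variable {i : ι} {β : ι → Type v} [∀ j, Fintype (β j)] (m : ∀ j,
  Module.Basis (β j) (Module.End Λᵐᵒᵖ (D.P j))ᵐᵒᵖ (RadTopHom Λᵐᵒᵖ (D.P i) (D.P j)))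
  {σ : ∀ i j, D.Arrow i j → D.TopRadHom i j}

theorem sum_sectionMap_basis_comp_bijective (hΛ : IsRightHereditary Λ)
    (hσ : ∀ i j h n, (radHomProj Λᵐᵒᵖ (D.P i) (D.P j)).toAddMonoidHom
      ((σ i j h).toAddMonoidHom n) = n) {k : ι} (hik : i ≠ k) :
    Function.Bijective fun f : ∀ b : Σ j, β j, D.P k →ₗ[Λᵐᵒᵖ] D.P b.1 =>
      ∑ b, D.sectionMap (σ i b.1 (D.arrow_of_basis (m b.1) b.2)) (m b.1 b.2) ∘ₗ f b := by
  classical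
  let s (b : Σ j, β j) : D.P b.1 →ₗ[Λᵐᵒᵖ] Rad Λᵐᵒᵖ (D.P i) :=
    (σ i b.1 (D.arrow_of_basis (m b.1) b.2)).toAddMonoidHom (m b.1 b.2)
  have hs (b : Σ j, β j) : Submodule.mkQ _ ∘ₗ s b = m b.1 b.2 := hσ i b.1 _ (m b.1 b.2)
  refine D.sum_subtype_comp_bijective (s := s) (D.lsum_bijective hΛ (fun k g => ?_) ?_) hik
  · simp only [hs]
    exact D.range_le_iSup_range_basis m g
  · simp only [hs]
    rintro k c hc ⟨_, l⟩ rfl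
    exact D.eq_zero_of_sum_basis_comp_eq_zero m hc l

end Basis

variable (hΛ : IsRightHereditary Λ)

/-- The modules `P i`, as a family indexed by the vertices of the modulated quiver. -/
def vertexModule : (D.modulatedQuiver hΛ).V → Type v := D.P

instance (i : (D.modulatedQuiver hΛ).V) : AddCommGroup (D.vertexModule hΛ i) := D.addCommGroupP i

instance (i : (D.modulatedQuiver hΛ).V) : Module Λᵐᵒᵖ (D.vertexModule hΛ i) := D.moduleP i

instance (i : (D.modulatedQuiver hΛ).V) : Module K (D.vertexModule hΛ i) := D.moduleKP i

instance (i : (D.modulatedQuiver hΛ).V) : IsScalarTower K Λᵐᵒᵖ (D.vertexModule hΛ i) := D.towerP i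

variable (σ : ∀ i j, D.Arrow i j → D.TopRadHom i j)

/-- The realization of the modulated quiver by the modules `P i` that is given by sections `σ` of
the projections `Hom(P j, rP i) → Hom(P j, rP i / r²P i)`. -/
noncomputable def realization :
    (D.modulatedQuiver hΛ).Realization Λᵐᵒᵖ (D.vertexModule hΛ) where
  vertex := fun (i : ι) => AlgHom.id K (Module.End Λᵐᵒᵖ (D.P i))
  arrow := @fun (i j : ι) a => D.sectionMap (σ i j a.down)
  arrow_left_smul := @fun (i j : ι) a f m =>
    congrArg (fun φ : D.P j →ₗ[Λᵐᵒᵖ] Rad Λᵐᵒᵖ (D.P i) =>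
      (Module.jacobson Λᵐᵒᵖ (D.P i)).subtype ∘ₗ φ) ((σ i j a.down).map_left_smul f m)
  arrow_right_smul := @fun (i j : ι) a g m =>
    congrArg (fun φ : D.P j →ₗ[Λᵐᵒᵖ] Rad Λᵐᵒᵖ (D.P i) =>
      (Module.jacobson Λᵐᵒᵖ (D.P i)).subtype ∘ₗ φ)
      ((σ i j a.down).map_right_smul (MulOpposite.op g) m)

theorem arrowElt_mem_rightSpan_basis {i : ι} {β : ι → Type v} (m : ∀ j,
    Module.Basis (β j) (Module.End Λᵐᵒᵖ (D.P j))ᵐᵒᵖ (RadTopHom Λᵐᵒᵖ (D.P i) (D.P j))) {j : ι}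
    (c : D.Arrow i j) (x : RadTopHom Λᵐᵒᵖ (D.P i) (D.P j)) :
    (D.modulatedQuiver hΛ).arrowElt (i := i) (j := j) ⟨c⟩ x ∈
      ModulatedQuiver.rightSpan (Q := D.modulatedQuiver hΛ) (i := i)
        (t := fun b : Σ j, β j => b.1) (fun b => ⟨D.arrow_of_basis (m b.1) b.2⟩)
        (fun b => m b.1 b.2) j := by
  refine ModulatedQuiver.arrowElt_mem_rightSpan_of_mem_span (Q := D.modulatedQuiver hΛ) (i := i)
    (j := j) (c := ⟨c⟩) (X := Set.range (m j)) ?_ ((m j).mem_span x)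
  rintro _ ⟨l, rfl⟩
  exact ModulatedQuiver.arrowElt_mem_rightSpan (Q := D.modulatedQuiver hΛ)
    (t := fun b : Σ j, β j => b.1) ⟨j, l⟩

variable {σ}

theorem realization_eval_bijective
    (hσ : ∀ i j h n, (radHomProj Λᵐᵒᵖ (D.P i) (D.P j)).toAddMonoidHom
      ((σ i j h).toAddMonoidHom n) = n) (i k : ι) :
    Function.Bijective ((D.realization hΛ σ).eval i k) := by
  induction hn : Module.finrank K (D.P i) using Nat.strong_induction_on generalizing i with
  | _ n ih =>
  subst hn
  by_cases hik : i = k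
  · subst hik
    exact (D.realization hΛ σ).eval_self_bijective Function.bijective_id
  · choose β hβ m using D.exists_basis_radTopHom hΛ i
    have m j := (m j).some
    exact (D.realization hΛ σ).eval_bijective_of_ne
      (fun c x => D.arrowElt_mem_rightSpan_basis hΛ m c.down x) hik
      (D.sum_sectionMap_basis_comp_bijective m hΛ hσ hik)
      (fun b => ih _ (D.finrank_lt_of_arrow hΛ (D.arrow_of_basis (m b.1) b.2)) b.1 rfl)

theorem isMoritaEquivalent_of_hasSection
    (h : ∀ i j, D.Arrow i j → (radHomProj Λᵐᵒᵖ (D.P i) (D.P j)).HasSection) :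
    IsMoritaEquivalent K Λᵐᵒᵖ (D.modulatedQuiver hΛ).TensorAlgebraᵐᵒᵖ := by
  classical
  choose σ hσ using h
  have (i : ι) := (D.cover i).projective
  have (i : ι) := D.isNoetherian i
  have : Module.Projective Λᵐᵒᵖ (∀ i : ι, D.P i) :=
    Module.Projective.of_equiv (DirectSum.linearEquivFunOnFintype Λᵐᵒᵖ ι D.P)
  let e : (D.modulatedQuiver hΛ).TensorAlgebra ≃ₐ[K] Module.End Λᵐᵒᵖ (∀ i : ι, D.P i) :=
    AlgEquiv.ofBijective (D.realization hΛ σ).toEnd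
      ((D.realization hΛ σ).toEnd_bijective (D.realization_eval_bijective hΛ hσ))
  exact isMoritaEquivalent_of_isGeneratorModule D.isGeneratorModule_pi
    ((AlgEquiv.opOp K _).symm.trans e)

end HasSection

end SimpleSystem

/-! ## Decomposable path sums and matrix units -/

namespace ModulatedQuiver

variable {K : Type u} [Field K] (Q : ModulatedQuiver.{u, v, w} K)

theorem incl_injective {a b : Q.V} (p : Quiver.Path a b) : Function.Injective (Q.incl p) := by
  classical
  exact DirectSum.of_injective (β := fun p : Quiver.Path a b => Q.TensorPath p) p

theorem idPath_ne_zero (a : Q.V) : Q.idPath a ≠ 0 := by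
  rw [idPath, Ne, map_eq_zero_iff _ (Q.incl_injective _),
    map_eq_zero_iff _ (Q.nilEquiv a).injective]
  exact one_ne_zero

theorem exists_comp_eq_idPath {a : Q.V} {x : Q.PathSum a a} (hx : x ≠ 0) :
    ∃ y, Q.comp a a a y x = Q.idPath a := by
  obtain ⟨f, rfl⟩ := Q.exists_incl_nil_eq x
  have hf : f ≠ 0 := by
    rintro rfl
    exact hx (by rw [map_zero, map_zero])
  refine ⟨Q.incl .nil (Q.nilEquiv a f⁻¹), ?_⟩
  rw [comp_incl, concat_nil, smul_nilEquiv, MulOpposite.unop_op, inv_mul_cancel₀ hf]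
  rfl

theorem comp_mem_of_incl_mem {a b c : Q.V} {S : Submodule K (Q.PathSum a c)}
    (h : ∀ (p : Quiver.Path a b) (q : Quiver.Path b c) (t : Q.TensorPath (p.comp q)),
      Q.incl (p.comp q) t ∈ S) (x : Q.PathSum a b) (y : Q.PathSum b c) :
    Q.comp a b c x y ∈ S := by
  refine Q.mem_of_incl_mem (S := S.comap ((Q.comp a b c).flip y)) (fun p t => ?_) x
  refine Q.mem_of_incl_mem (S := S.comap (Q.comp a b c (Q.incl p t))) (fun q s => ?_) y
  rw [Submodule.mem_comap, comp_incl]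
  exact h p q _

theorem comp_eq_zero_of_ne {a b : Q.V} (hab : a ≠ b) (x : Q.PathSum a b) (y : Q.PathSum b a) :
    Q.comp a b a x y = 0 := by
  refine (Submodule.mem_bot K).1 (Q.comp_mem_of_incl_mem (fun p q _ => ?_) x y)
  have hpq := Q.length_eq_zero_of_cycle (p.comp q)
  rw [Quiver.Path.length_comp, Nat.add_eq_zero_iff] at hpq
  exact absurd (Quiver.Path.eq_of_length_zero p hpq.1) hab

/-- The subspace of the path sum from `a` to `b` that is spanned by the products through a third
vertex. It is the part of the paths of length at least two when `a ≠ b`. -/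
noncomputable def decomposable (a b : Q.V) : Submodule K (Q.PathSum a b) :=
  Submodule.span K {x | ∃ (c : Q.V) (y : Q.PathSum a c) (z : Q.PathSum c b),
    a ≠ c ∧ c ≠ b ∧ Q.comp a c b y z = x}

theorem comp_mem_decomposable {a b c : Q.V} (hac : a ≠ c) (hcb : c ≠ b) (y : Q.PathSum a c)
    (z : Q.PathSum c b) : Q.comp a c b y z ∈ Q.decomposable a b :=
  Submodule.subset_span ⟨c, y, z, hac, hcb, rfl⟩

theorem decomposable_induction {a b : Q.V} {motive : Q.PathSum a b → Prop} (zero : motive 0)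
    (add : ∀ x y, motive x → motive y → motive (x + y))
    (comp : ∀ (c : Q.V) (y : Q.PathSum a c) (z : Q.PathSum c b), a ≠ c → c ≠ b →
      motive (Q.comp a c b y z)) {x : Q.PathSum a b} (hx : x ∈ Q.decomposable a b) :
    motive x := by
  induction hx using Submodule.closure_induction with
  | zero => exact zero
  | add x y _ _ hx hy => exact add x y hx hy
  | smul_mem r x hx =>
    obtain ⟨c, y, z, hac, hcb, rfl⟩ := hx
    have := comp c (r • y) z hac hcb
    rwa [map_smul, LinearMap.smul_apply] at this

theorem incl_mem_decomposable {a b : Q.V} {p : Quiver.Path a b} (hp : 2 ≤ p.length)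
    (t : Q.TensorPath p) : Q.incl p t ∈ Q.decomposable a b := by
  cases p with
  | nil => exact absurd hp (Nat.not_succ_le_zero 1)
  | cons p e =>
    refine Q.incl_cons_mem (fun t m => ?_) t
    rw [incl_snoc]
    refine Q.comp_mem_decomposable ?_ ?_ _ _
    · rintro rfl
      rw [Quiver.Path.length_cons, Q.length_eq_zero_of_cycle p] at hp
      omega
    · rintro rfl
      exact Q.acyclic _ (.single e.down)

open Classical in
/-- The projection of a path sum onto the part of the paths of length one. -/
noncomputable def arrowPart (a b : Q.V) : Q.PathSum a b →ₗ[K] Q.PathSum a b :=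
  DirectSum.toModule K _ _ (fun p => if p.length = 1 then Q.incl p else 0)

theorem arrowPart_incl_of_eq {a b : Q.V} {p : Quiver.Path a b} (hp : p.length = 1)
    (t : Q.TensorPath p) : Q.arrowPart a b (Q.incl p t) = Q.incl p t := by
  simp only [arrowPart, incl, DirectSum.toModule_lof]
  rw [if_pos hp]

theorem arrowPart_incl_of_ne {a b : Q.V} {p : Quiver.Path a b} (hp : p.length ≠ 1)
    (t : Q.TensorPath p) : Q.arrowPart a b (Q.incl p t) = 0 := by
  simp only [arrowPart, incl, DirectSum.toModule_lof]
  rw [if_neg hp]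
  rfl

theorem arrowPart_eq_zero {a b : Q.V} {x : Q.PathSum a b} (hx : x ∈ Q.decomposable a b) :
    Q.arrowPart a b x = 0 := by
  suffices Q.decomposable a b ≤ LinearMap.ker (Q.arrowPart a b) from this hx
  refine Submodule.span_le.2 ?_
  rintro _ ⟨c, y, z, hac, hcb, rfl⟩
  refine Q.comp_mem_of_incl_mem (fun p q t => Q.arrowPart_incl_of_ne ?_ t) y z
  have hp : p.length ≠ 0 := fun h => hac (Quiver.Path.eq_of_length_zero p h)
  have hq : q.length ≠ 0 := fun h => hcb (Quiver.Path.eq_of_length_zero q h)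
  rw [Quiver.Path.length_comp]
  omega

theorem sub_arrowPart_mem_decomposable {a b : Q.V} (hab : a ≠ b) (x : Q.PathSum a b) :
    x - Q.arrowPart a b x ∈ Q.decomposable a b := by
  refine Q.mem_of_incl_mem (S := (Q.decomposable a b).comap (LinearMap.id - Q.arrowPart a b))
    (fun p t => ?_) x
  change Q.incl p t - Q.arrowPart a b (Q.incl p t) ∈ Q.decomposable a b
  by_cases hp : p.length = 1
  · rw [Q.arrowPart_incl_of_eq hp, sub_self]
    exact Submodule.zero_mem _
  · rw [Q.arrowPart_incl_of_ne hp, sub_zero]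
    have : p.length ≠ 0 := fun h => hab (Quiver.Path.eq_of_length_zero p h)
    exact Q.incl_mem_decomposable (by omega) t

theorem arrowPart_comp_left {a b : Q.V} (z : Q.PathSum a a) (x : Q.PathSum a b) :
    Q.arrowPart a b (Q.comp a a b z x) = Q.comp a a b z (Q.arrowPart a b x) := by
  obtain ⟨f, rfl⟩ := Q.exists_incl_nil_eq z
  refine LinearMap.congr_fun (f := (Q.arrowPart a b).comp (Q.comp a a b (Q.incl .nil _)))
    (g := (Q.comp a a b (Q.incl .nil _)).comp (Q.arrowPart a b))
    (Q.pathSum_hom_ext fun p t => ?_) x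
  have hl : (Quiver.Path.nil.comp p).length = p.length := by rw [Quiver.Path.nil_comp]
  rw [LinearMap.comp_apply, LinearMap.comp_apply, comp_incl]
  by_cases hp : p.length = 1
  · rw [arrowPart_incl_of_eq _ (hl.trans hp), arrowPart_incl_of_eq _ hp, comp_incl]
  · rw [arrowPart_incl_of_ne _ (hl.trans_ne hp), arrowPart_incl_of_ne _ hp, map_zero]

theorem arrowPart_comp_right {a b : Q.V} (x : Q.PathSum a b) (z : Q.PathSum b b) :
    Q.arrowPart a b (Q.comp a b b x z) = Q.comp a b b (Q.arrowPart a b x) z := by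
  obtain ⟨f, rfl⟩ := Q.exists_incl_nil_eq z
  refine LinearMap.congr_fun (f := (Q.arrowPart a b).comp ((Q.comp a b b).flip (Q.incl .nil _)))
    (g := ((Q.comp a b b).flip (Q.incl .nil _)).comp (Q.arrowPart a b))
    (Q.pathSum_hom_ext fun p t => ?_) x
  simp only [LinearMap.comp_apply, LinearMap.flip_apply, comp_incl]
  by_cases hp : p.length = 1
  · rw [arrowPart_incl_of_eq _ (p := p.comp .nil) hp, arrowPart_incl_of_eq _ hp, comp_incl]
  · rw [arrowPart_incl_of_ne _ (p := p.comp .nil) hp, arrowPart_incl_of_ne _ hp, map_zero,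
      LinearMap.zero_apply]

namespace TensorAlgebra

variable {Q}

open Classical in
/-- The element of the tensor algebra with one given component. -/
noncomputable def single (a b : Q.V) : Q.PathSum a b →+ Q.TensorAlgebra where
  toFun x := Pi.single a (Pi.single b x)
  map_zero' := (congrArg (Pi.single a) (Pi.single_zero b)).trans (Pi.single_zero a)
  map_add' x y := (congrArg (Pi.single a) (Pi.single_add b x y)).trans (Pi.single_add a _ _)

theorem single_apply_same (a b : Q.V) (x : Q.PathSum a b) : single a b x a b = x := by
  classical
  exact (congrFun (Pi.single_eq_same a _) b).trans (Pi.single_eq_same b x)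

theorem single_apply_of_ne_left {a b : Q.V} (x : Q.PathSum a b) {i : Q.V} (h : i ≠ a) (j : Q.V) :
    single a b x i j = 0 := by
  classical
  exact congrFun (Pi.single_eq_of_ne h (M := fun i => ∀ j, Q.PathSum i j) _) j

theorem single_apply_of_ne_right {a b : Q.V} (x : Q.PathSum a b) (i : Q.V) {j : Q.V} (h : j ≠ b) :
    single a b x i j = 0 := by
  classical
  obtain rfl | hi := eq_or_ne i a
  · exact (congrFun (Pi.single_eq_same i _) j).trans (Pi.single_eq_of_ne h x)
  · exact single_apply_of_ne_left x hi j

theorem single_injective (a b : Q.V) : Function.Injective (single (Q := Q) a b) :=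
  Function.LeftInverse.injective (g := fun t : Q.TensorAlgebra => t a b) (single_apply_same a b)

theorem mul_single_apply {a b : Q.V} (t : Q.TensorAlgebra) (x : Q.PathSum a b) (i : Q.V) :
    (t * single a b x) i b = Q.comp i a b (t i a) x := by
  rw [mul_apply, Finset.sum_eq_single a, single_apply_same]
  · intro k _ hk
    rw [single_apply_of_ne_left _ hk b, map_zero]
  · exact fun h => absurd (Finset.mem_univ a) h

theorem single_mul_apply {a b : Q.V} (x : Q.PathSum a b) (t : Q.TensorAlgebra) (j : Q.V) :
    (single a b x * t) a j = Q.comp a b j x (t b j) := by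
  rw [mul_apply, Finset.sum_eq_single b, single_apply_same]
  · intro k _ hk
    rw [single_apply_of_ne_right _ a hk, map_zero, LinearMap.zero_apply]
  · exact fun h => absurd (Finset.mem_univ b) h

theorem single_mul_mul_single {a b c d : Q.V} (x : Q.PathSum a b) (t : Q.TensorAlgebra)
    (y : Q.PathSum c d) :
    single a b x * t * single c d y =
      single a d (Q.comp a c d (Q.comp a b c x (t b c)) y) := by
  refine ext fun i j => ?_
  obtain rfl | hj := eq_or_ne j d
  · rw [mul_single_apply]
    obtain rfl | hi := eq_or_ne i a
    · rw [single_mul_apply, single_apply_same]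
    · have h : (single a b x * t) i c = 0 := Finset.sum_eq_zero fun k _ => by
        rw [single_apply_of_ne_left _ hi k, map_zero, LinearMap.zero_apply]
      rw [single_apply_of_ne_left _ hi, h, map_zero, LinearMap.zero_apply]
  · rw [single_apply_of_ne_right _ _ hj, mul_apply]
    exact Finset.sum_eq_zero fun k _ => by rw [single_apply_of_ne_right _ k hj, map_zero]

theorem single_mul_single {a b c : Q.V} (x : Q.PathSum a b) (y : Q.PathSum b c) :
    single a b x * single b c y = single a c (Q.comp a b c x y) := by
  rw [← mul_one (single a b x), single_mul_mul_single, one_apply_same, comp_id]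

theorem single_id_mul_mul_single_id (a b : Q.V) (t : Q.TensorAlgebra) :
    single a a (Q.idPath a) * t * single b b (Q.idPath b) = single a b (t a b) := by
  rw [single_mul_mul_single, id_comp, comp_id]

theorem sum_single_id : ∑ a, single a a (Q.idPath a) = (1 : Q.TensorAlgebra) := by
  refine ext fun i j => ?_
  let ev : Q.TensorAlgebra →+ Q.PathSum i j :=
    { toFun := fun t => t i j, map_zero' := rfl, map_add' := fun _ _ => rfl }
  refine (map_sum ev _ _).trans ?_
  change ∑ a, single a a (Q.idPath a) i j = _
  rw [Finset.sum_eq_single i]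
  · obtain rfl | h := eq_or_ne i j
    · rw [single_apply_same, one_apply_same]
    · rw [single_apply_of_ne_right _ _ h.symm, one_apply_ne h]
  · intro k _ hk
    rw [single_apply_of_ne_left _ hk.symm]
  · exact fun h => absurd (Finset.mem_univ i) h

end TensorAlgebra

end ModulatedQuiver

/-! ## Morita equivalences with tensor algebras -/

section Generator

universe u₁ u₂ u₃

theorem exists_isSeparator_of_equivalence {A : Type u₁} [Ring A] {B : Type u₂} [Ring B]
    [Small.{u₃} A] [Small.{u₃} B] (E : ModuleCat.{u₃} A ≌ ModuleCat.{u₃} B)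
    [E.functor.Additive] :
    ∃ Z : ModuleCat.{u₃} A, Module.Projective A Z ∧ IsSeparator Z ∧
      Nonempty (Bᵐᵒᵖ ≃+* Module.End A Z) := by
  let U : ModuleCat.{u₃} B := ModuleCat.of B (Shrink.{u₃} B)
  have hU : Projective U := (IsProjective.iff_projective _).1
    (Module.Projective.of_equiv (Shrink.linearEquiv B B).symm)
  let mapEnd : Module.End B U ≃+* Module.End A (E.inverse.obj U) :=
    { toFun := fun f => (E.inverse.map (ModuleCat.ofHom f)).hom
      invFun := fun g => (E.inverse.preimage (ModuleCat.ofHom g)).hom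
      left_inv := fun f => by simp
      right_inv := fun g => by simp
      map_mul' := fun f g => congrArg ModuleCat.Hom.hom
        (E.inverse.map_comp (ModuleCat.ofHom g) (ModuleCat.ofHom f))
      map_add' := fun f g => congrArg ModuleCat.Hom.hom
        (E.inverse.map_add (f := ModuleCat.ofHom f) (g := ModuleCat.ofHom g)) }
  exact ⟨E.inverse.obj U, (IsProjective.iff_projective _).2 ((E.symm.map_projective_iff U).2 hU),
    (ModuleCat.isSeparator B).of_equivalence E.symm,
    ⟨((RingEquiv.moduleEndSelf B).trans (Shrink.linearEquiv B B).symm.conjRingEquiv).trans mapEnd⟩⟩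

theorem exists_ne_zero_of_isSeparator {A : Type u₁} [Ring A] {Z : ModuleCat.{max u₂ u₃} A}
    (hZ : IsSeparator Z) (X : Type u₂) [AddCommGroup X] [Module A X] [Nontrivial X] :
    ∃ g : Z →ₗ[A] X, g ≠ 0 := by
  by_contra! h
  have hid : 𝟙 (ModuleCat.of A (ULift.{u₃} X)) = 0 :=
    (Preadditive.isSeparator_iff Z).1 hZ _ fun g => ModuleCat.hom_ext <| LinearMap.ext fun z =>
      ULift.down_injective (LinearMap.congr_fun (h (ULift.moduleEquiv.toLinearMap ∘ₗ g.hom)) z)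
  obtain ⟨x, hx⟩ := exists_ne (0 : X)
  exact hx (congrArg ULift.down (LinearMap.congr_fun (congrArg ModuleCat.Hom.hom hid) ⟨x⟩))

end Generator

theorem comp_eq_id_of_comp_comp_eq {R X Z : Type*} [Ring R] [AddCommGroup X] [Module R X]
    [AddCommGroup Z] [Module R Z] (hX : ∀ f : Module.End R X, IsUnit f ∨ f = 0)
    {p : X →ₗ[R] Z} {q : Z →ₗ[R] X} (hq : q ≠ 0) (h : q ∘ₗ p ∘ₗ q = q) : q ∘ₗ p = LinearMap.id := by
  have hidem : IsIdempotentElem (q ∘ₗ p : Module.End R X) :=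
    congrArg (fun f : Z →ₗ[R] X => f ∘ₗ p) h
  refine (IsIdempotentElem.iff_eq_one_of_isUnit ((hX _).resolve_right fun h0 => hq ?_)).1 hidem
  rw [← h, ← LinearMap.comp_assoc, h0, LinearMap.zero_comp]

namespace ModulatedQuiver

variable {K : Type u} [Field K] {Q : ModulatedQuiver.{u, v, w} K}

open ModulatedQuiver.TensorAlgebra

section Multiplicative

variable {R : Type*} [Ring R] {X : Q.V → Type*} [∀ a, AddCommGroup (X a)] [∀ a, Module R (X a)]

/-- Identifications of the homomorphisms between a family of modules, indexed by the vertices, with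
the path sums are multiplicative if composition corresponds to concatenation of paths. -/
def IsMultiplicative (Φ : ∀ a b, (X b →ₗ[R] X a) ≃+ Q.PathSum a b) : Prop :=
  ∀ (a b c : Q.V) (f : X b →ₗ[R] X a) (g : X c →ₗ[R] X b),
    Φ a c (f ∘ₗ g) = Q.comp a b c (Φ a b f) (Φ b c g)

theorem exists_isMultiplicative {Z : Type*} [AddCommGroup Z] [Module R Z]
    (Θ : Module.End R Z ≃+* Q.TensorAlgebra) {p : ∀ a, X a →ₗ[R] Z} {q : ∀ a, Z →ₗ[R] X a}
    (hqp : ∀ a, q a ∘ₗ p a = LinearMap.id)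
    (hpq : ∀ a, Θ (p a ∘ₗ q a) = single a a (Q.idPath a)) :
    ∃ Φ : ∀ a b, (X b →ₗ[R] X a) ≃+ Q.PathSum a b, IsMultiplicative Φ := by
  have hqp' a x : q a (p a x) = x := LinearMap.congr_fun (hqp a) x
  have hsingle a b (f : X b →ₗ[R] X a) :
      Θ (p a ∘ₗ f ∘ₗ q b) = single a b (Θ (p a ∘ₗ f ∘ₗ q b) a b) := by
    rw [← single_id_mul_mul_single_id, ← hpq, ← hpq, ← map_mul, ← map_mul]
    refine congrArg Θ (LinearMap.ext fun x => ?_)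
    simp only [Module.End.mul_apply, LinearMap.comp_apply, hqp']
  refine ⟨fun a b =>
    { toFun := fun f => Θ (p a ∘ₗ f ∘ₗ q b) a b
      invFun := fun x => q a ∘ₗ Θ.symm (single a b x) ∘ₗ p b
      left_inv := fun f => LinearMap.ext fun x => ?_
      right_inv := fun x => ?_
      map_add' := fun f g => ?_ }, fun a b c f g => ?_⟩
  · beta_reduce
    rw [← hsingle, Θ.symm_apply_apply]
    simp only [LinearMap.comp_apply, hqp']
  · have hmul : p a ∘ₗ (q a ∘ₗ Θ.symm (single a b x) ∘ₗ p b) ∘ₗ q b =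
        (p a ∘ₗ q a) * Θ.symm (single a b x) * (p b ∘ₗ q b) := rfl
    beta_reduce
    rw [hmul, map_mul, map_mul, hpq, hpq, Θ.apply_symm_apply, single_id_mul_mul_single_id,
      single_apply_same, single_apply_same]
  · rw [← TensorAlgebra.add_apply, ← map_add, LinearMap.add_comp, LinearMap.comp_add]
  · have hmul : p a ∘ₗ (f ∘ₗ g) ∘ₗ q c = (p a ∘ₗ f ∘ₗ q b) * (p b ∘ₗ g ∘ₗ q c) :=
      LinearMap.ext fun x => by simp only [Module.End.mul_apply, LinearMap.comp_apply, hqp']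
    refine single_injective a c ?_
    simp only [AddEquiv.coe_mk, Equiv.coe_fn_mk]
    rw [← single_mul_single, ← hsingle, ← hsingle, ← hsingle, ← map_mul, hmul]

theorem IsMultiplicative.eq_of_linearEquiv {Φ : ∀ a b, (X b →ₗ[R] X a) ≃+ Q.PathSum a b}
    (hΦ : IsMultiplicative Φ) {a b : Q.V} [Nontrivial (X a)] (e : X a ≃ₗ[R] X b) : a = b := by
  by_contra hab
  have hzero : e.symm.toLinearMap ∘ₗ e.toLinearMap = 0 := by
    rw [← map_eq_zero_iff _ (Φ a a).injective, hΦ, Q.comp_eq_zero_of_ne hab]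
  obtain ⟨x, hx⟩ := exists_ne (0 : X a)
  exact hx ((e.symm_apply_apply x).symm.trans (LinearMap.congr_fun hzero x))

end Multiplicative

end ModulatedQuiver

namespace SimpleSystem

variable {K : Type u} [Field K] {Λ : Type v} [Ring Λ] [Algebra K Λ] [Module.Finite K Λ]
  {ι : Type w} (D : SimpleSystem K Λ ι)

theorem isUnit_or_eq_zero (hΛ : IsRightHereditary Λ) (i : ι) (f : Module.End Λᵐᵒᵖ (D.P i)) :
    IsUnit f ∨ f = 0 :=
  have : Module.Finite K Λᵐᵒᵖ := Module.Finite.equiv (MulOpposite.opLinearEquiv K)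
  (D.cover i).isUnit_or_eq_zero K hΛ f

theorem eq_zero_of_mem_jacobson (hΛ : IsRightHereditary Λ) {i : ι} {f : Module.End Λᵐᵒᵖ (D.P i)}
    (hf : ∀ x, f x ∈ Module.jacobson Λᵐᵒᵖ (D.P i)) : f = 0 := by
  refine (D.isUnit_or_eq_zero hΛ i f).resolve_left fun hu => ?_
  refine (D.cover i).isCoatom_ker.1 (eq_top_iff.2 fun x _ => ?_)
  obtain ⟨y, rfl⟩ := ((Module.End.isUnit_iff f).1 hu).2 x
  rw [← (D.cover i).jacobson_eq_ker]
  exact hf y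

section Vertices

open ModulatedQuiver.TensorAlgebra

variable [Finite ι] {Q : ModulatedQuiver K}

theorem exists_vertexSummand (hΛ : IsRightHereditary Λ) {Z : Type*} [AddCommGroup Z]
    [Module Λᵐᵒᵖ Z] [Module.Projective Λᵐᵒᵖ Z] (Θ : Module.End Λᵐᵒᵖ Z ≃+* Q.TensorAlgebra)
    (b : Q.V) :
    ∃ (k : ι) (p : D.P k →ₗ[Λᵐᵒᵖ] Z) (q : Z →ₗ[Λᵐᵒᵖ] D.P k),
      q ∘ₗ p = LinearMap.id ∧ Θ (p ∘ₗ q) = single b b (Q.idPath b) := by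
  let ε : Module.End Λᵐᵒᵖ Z := Θ.symm (single b b (Q.idPath b))
  have hΘε : Θ ε = single b b (Q.idPath b) := Θ.apply_symm_apply _
  have hε : ε * ε = ε := Θ.injective (by rw [map_mul, hΘε, single_mul_single, Q.comp_id])
  have hε_ne : ε ≠ 0 := fun h => Q.idPath_ne_zero b
    (single_injective b b (by rw [← hΘε, h, map_zero, map_zero]))
  obtain ⟨z, hz⟩ : ∃ z, ε z ≠ 0 := by
    by_contra! h
    exact hε_ne (LinearMap.ext h)
  obtain ⟨k, s, t, hst⟩ := D.exists_comp_comp_apply_ne_zero ε (x := ε z)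
    (by rwa [← Module.End.mul_apply, hε])
  let f : Module.End Λᵐᵒᵖ Z := t ∘ₗ s
  have hf : Θ f b b ≠ 0 := fun h => by
    have hεfε : ε * f * ε = 0 := Θ.injective (by
      rw [map_mul, map_mul, hΘε, single_id_mul_mul_single_id, h, map_zero, map_zero])
    exact hst (LinearMap.congr_fun hεfε z)
  obtain ⟨y, hy⟩ := Q.exists_comp_eq_idPath hf
  have hpq : (Θ.symm (single b b y) ∘ₗ t) ∘ₗ (s ∘ₗ ε) = ε := by
    refine Θ.injective ?_
    change Θ (Θ.symm (single b b y) * f * ε) = Θ ε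
    rw [map_mul, map_mul, Θ.apply_symm_apply, hΘε, single_mul_mul_single, hy, Q.comp_id]
  refine ⟨k, _, s ∘ₗ ε, comp_eq_id_of_comp_comp_eq (D.isUnit_or_eq_zero hΛ k) ?_ ?_,
    (congrArg Θ hpq).trans hΘε⟩
  · intro h
    exact hε_ne (by rw [← hpq, h, LinearMap.comp_zero])
  · rw [hpq, LinearMap.comp_assoc]
    exact congrArg (s ∘ₗ ·) hε

open scoped ModuleCat.Algebra in
theorem exists_vertexEquiv (hΛ : IsRightHereditary Λ)
    (h : IsMoritaEquivalent K Λᵐᵒᵖ Q.TensorAlgebraᵐᵒᵖ) :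
    ∃ (τ : Q.V ≃ ι) (Φ : ∀ a b, (D.P (τ b) →ₗ[Λᵐᵒᵖ] D.P (τ a)) ≃+ Q.PathSum a b),
      ModulatedQuiver.IsMultiplicative Φ := by
  obtain ⟨⟨M⟩⟩ := h
  obtain ⟨Z, _, hZ, ⟨e⟩⟩ := exists_isSeparator_of_equivalence M.eqv
  let Θ : Module.End Λᵐᵒᵖ Z ≃+* Q.TensorAlgebra := ((RingEquiv.opOp _).trans e).symm
  choose τ p q hqp hpq using D.exists_vertexSummand hΛ Θ
  obtain ⟨Φ, hΦ⟩ := ModulatedQuiver.exists_isMultiplicative Θ hqp hpq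
  refine ⟨Equiv.ofBijective τ ⟨fun a b hab => ?_, fun i => ?_⟩, Φ, hΦ⟩
  · have := (D.cover (τ a)).nontrivial
    exact hΦ.eq_of_linearEquiv (LinearEquiv.cast (R := Λᵐᵒᵖ) (M := D.P) hab)
  · have := IsSimpleModule.nontrivial Λᵐᵒᵖ (D.S i)
    obtain ⟨g, hg⟩ := exists_ne_zero_of_isSeparator hZ (D.S i)
    obtain ⟨b, hb⟩ : ∃ b, g ∘ₗ p b ≠ 0 := by
      by_contra! hgp
      have hsum : ∑ b, p b ∘ₗ q b = (1 : Module.End Λᵐᵒᵖ Z) :=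
        Θ.injective (by simp only [map_sum, hpq, sum_single_id, map_one])
      refine hg (LinearMap.ext fun z => ?_)
      rw [← Module.End.one_apply (R := Λᵐᵒᵖ) z, ← hsum, LinearMap.sum_apply, map_sum]
      exact Finset.sum_eq_zero fun b _ => LinearMap.congr_fun (hgp b) (q b z)
    exact ⟨b, (D.eq_of_iso _ _ ((D.cover (τ b)).nonempty_equiv_of_ne_zero hb)).symm⟩

end Vertices

end SimpleSystem

theorem BimoduleHom.hasSection_of_surjective {F G M N : Type*} [Ring F] [Ring G] [AddCommGroup M]
    [AddCommGroup N] [Module F M] [Module Gᵐᵒᵖ M] [Module F N] [Module Gᵐᵒᵖ N]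
    {p : BimoduleHom F G M N} (hp : Function.Surjective p.toAddMonoidHom) (e : BimoduleHom F G M M)
    (hker : ∀ m, p.toAddMonoidHom m = 0 → e.toAddMonoidHom m = 0)
    (hpe : ∀ m, p.toAddMonoidHom (e.toAddMonoidHom m) = p.toAddMonoidHom m) : p.HasSection := by
  have hsurjInv := Function.surjInv_eq hp
  have he {m m'} (h : p.toAddMonoidHom m = p.toAddMonoidHom m') :
      e.toAddMonoidHom m = e.toAddMonoidHom m' := by
    rw [← sub_eq_zero, ← map_sub]
    exact hker _ (by rw [map_sub, h, sub_self])
  let σ : N →+ M := AddMonoidHom.mk' (fun n => e.toAddMonoidHom (Function.surjInv hp n))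
    fun n n' => (he (by simp only [map_add, hsurjInv])).trans (map_add _ _ _)
  refine ⟨{ σ with
    map_left_smul := fun f n => (he ?_).trans (e.map_left_smul f _)
    map_right_smul := fun g n => (he ?_).trans (e.map_right_smul g _) }, fun n => ?_⟩
  · exact (hsurjInv _).trans
      ((congrArg (f • ·) (hsurjInv n)).symm.trans (p.map_left_smul f _).symm)
  · exact (hsurjInv _).trans
      ((congrArg (g • ·) (hsurjInv n)).symm.trans (p.map_right_smul g _).symm)
  · exact (hpe _).trans (hsurjInv n)

namespace SimpleSystem

theorem hasSection_of_addMonoidHom {K : Type u} [Field K] {Λ : Type v} [Ring Λ] [Algebra K Λ]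
    {ι : Type w} (D : SimpleSystem K Λ ι) {i j : ι} (hij : i ≠ j)
    (E : (D.P j →ₗ[Λᵐᵒᵖ] D.P i) →+ (D.P j →ₗ[Λᵐᵒᵖ] D.P i))
    (hE_left : ∀ (f : Module.End Λᵐᵒᵖ (D.P i)) φ, E (f ∘ₗ φ) = f ∘ₗ E φ)
    (hE_right : ∀ φ (f : Module.End Λᵐᵒᵖ (D.P j)), E (φ ∘ₗ f) = E φ ∘ₗ f)
    (hE_rad : ∀ φ : D.P j →ₗ[Λᵐᵒᵖ] Rad Λᵐᵒᵖ (D.P i),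
      (radHomProj Λᵐᵒᵖ (D.P i) (D.P j)).toAddMonoidHom φ = 0 →
        E ((Module.jacobson Λᵐᵒᵖ (D.P i)).subtype ∘ₗ φ) = 0)
    (hE_sub : ∀ φ, (radHomProj Λᵐᵒᵖ (D.P i) (D.P j)).toAddMonoidHom
      (D.toRad hij (φ - E φ)) = 0) :
    (radHomProj Λᵐᵒᵖ (D.P i) (D.P j)).HasSection := by
  have := (D.cover j).projective
  let incl : RadHom Λᵐᵒᵖ (D.P i) (D.P j) →+ (D.P j →ₗ[Λᵐᵒᵖ] D.P i) :=
    AddMonoidHom.mk' (fun φ => Submodule.subtype _ ∘ₗ (φ : D.P j →ₗ[Λᵐᵒᵖ] Rad Λᵐᵒᵖ _))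
      fun _ _ => LinearMap.comp_add _ _ _
  let e : BimoduleHom (Module.End Λᵐᵒᵖ (D.P i)) (Module.End Λᵐᵒᵖ (D.P j))
      (RadHom Λᵐᵒᵖ (D.P i) (D.P j)) (RadHom Λᵐᵒᵖ (D.P i) (D.P j)) :=
    { AddMonoidHom.mk' (fun φ => D.toRad hij (E (incl φ))) fun φ ψ =>
        congrArg (D.toRad hij) (map_add (E.comp incl) φ ψ) with
      map_left_smul := fun f φ => congrArg (D.toRad hij) (hE_left f (incl φ))
      map_right_smul := fun f φ => congrArg (D.toRad hij) (hE_right (incl φ) f.unop) }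
  refine BimoduleHom.hasSection_of_surjective (radHomProj_surjective Λᵐᵒᵖ _ _) e
    (fun φ hφ => congrArg (D.toRad hij) (hE_rad φ hφ)) (fun φ => ?_)
  have hzero := hE_sub (incl φ)
  exact (sub_eq_zero.1 ((map_sub _ φ (D.toRad hij (E (incl φ)))).symm.trans hzero)).symm

section VertexEquiv

variable {K : Type u} [Field K] {Λ : Type v} [Ring Λ] [Algebra K Λ] {ι : Type w}
  {D : SimpleSystem K Λ ι} {Q : ModulatedQuiver K} {τ : Q.V ≃ ι}
  {Φ : ∀ a b, (D.P (τ b) →ₗ[Λᵐᵒᵖ] D.P (τ a)) ≃+ Q.PathSum a b} {a b : Q.V}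

theorem radHomProj_toRad_symm_eq_zero (hΦ : ModulatedQuiver.IsMultiplicative Φ) (hab : τ a ≠ τ b)
    {x : Q.PathSum a b} (hx : x ∈ Q.decomposable a b) :
    (radHomProj Λᵐᵒᵖ (D.P (τ a)) (D.P (τ b))).toAddMonoidHom
      (D.toRad hab ((Φ a b).symm x)) = 0 := by
  refine Q.decomposable_induction (motive := fun x => (radHomProj Λᵐᵒᵖ _ _).toAddMonoidHom
    (D.toRad hab ((Φ a b).symm x)) = 0) ?_ (fun x y hx hy => ?_) (fun c y z hac hcb => ?_) hx
  · rw [map_zero]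
    exact map_zero _
  · rw [map_add]
    exact (map_add _ (D.toRad hab _) (D.toRad hab _)).trans (by rw [hx, hy, add_zero])
  · have hcomp : (Φ a b).symm (Q.comp a c b y z) = (Φ a c).symm y ∘ₗ (Φ c b).symm z := by
      rw [AddEquiv.symm_apply_eq, hΦ, AddEquiv.apply_symm_apply, AddEquiv.apply_symm_apply]
    rw [hcomp]
    exact D.comp_eq_zero_of_ne (τ.injective.ne hcb)
      (Submodule.mkQ _ ∘ₗ D.toRad (τ.injective.ne hac) ((Φ a c).symm y)) ((Φ c b).symm z)

theorem mem_decomposable_of_radHomProj_eq_zero [Finite ι] [Module.Finite K Λ]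
    (hΛ : IsRightHereditary Λ) (hΦ : ModulatedQuiver.IsMultiplicative Φ)
    {φ : D.P (τ b) →ₗ[Λᵐᵒᵖ] Rad Λᵐᵒᵖ (D.P (τ a))}
    (hφ : (radHomProj Λᵐᵒᵖ (D.P (τ a)) (D.P (τ b))).toAddMonoidHom φ = 0) :
    Φ a b ((Module.jacobson Λᵐᵒᵖ (D.P (τ a))).subtype ∘ₗ φ) ∈ Q.decomposable a b := by
  have hφ_mem (x) : φ x ∈ Module.jacobson Λᵐᵒᵖ (Rad Λᵐᵒᵖ (D.P (τ a))) :=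
    (Submodule.Quotient.mk_eq_zero _).1 (LinearMap.congr_fun hφ x)
  have hmem (c : Q.V) (s : Rad Λᵐᵒᵖ (D.P (τ a)) →ₗ[Λᵐᵒᵖ] D.P (τ c))
      (t : D.P (τ c) →ₗ[Λᵐᵒᵖ] Rad Λᵐᵒᵖ (D.P (τ a))) :
      Φ a b ((Submodule.subtype _ ∘ₗ t) ∘ₗ (s ∘ₗ φ)) ∈ Q.decomposable a b := by
    rw [hΦ]
    obtain rfl | hac := eq_or_ne a c
    · have hzero : Submodule.subtype _ ∘ₗ t = 0 :=
        D.eq_zero_of_mem_jacobson hΛ fun x => (t x).2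
      simp only [hzero, map_zero, LinearMap.zero_apply, zero_mem]
    obtain rfl | hcb := eq_or_ne c b
    · have hzero : s ∘ₗ φ = 0 :=
        D.eq_zero_of_mem_jacobson hΛ fun x => Module.le_comap_jacobson s (hφ_mem x)
      simp only [hzero, map_zero, zero_mem]
    exact Q.comp_mem_decomposable hac hcb _ _
  have := D.isNoetherian (τ a)
  have := (D.cover (τ a)).projective_submodule hΛ (Module.jacobson Λᵐᵒᵖ (D.P (τ a)))
  obtain ⟨α, _, k, s, t, hst⟩ := D.exists_sum_comp_eq_id (X := Rad Λᵐᵒᵖ (D.P (τ a)))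
  obtain ⟨c, rfl⟩ := τ.surjective.comp_left k
  have hsum : Submodule.subtype _ ∘ₗ φ = ∑ l, (Submodule.subtype _ ∘ₗ t l) ∘ₗ (s l ∘ₗ φ) := by
    refine LinearMap.ext fun x => ?_
    have hx := congrArg (Submodule.subtype _) (LinearMap.congr_fun hst (φ x))
    rw [LinearMap.sum_apply, map_sum] at hx
    rw [LinearMap.sum_apply]
    exact hx.symm
  rw [hsum, map_sum]
  exact Submodule.sum_mem _ fun l _ => hmem (c l) (s l) (t l)

theorem hasSection_of_vertexEquiv [Finite ι] [Module.Finite K Λ] (hΛ : IsRightHereditary Λ)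
    (hΦ : ModulatedQuiver.IsMultiplicative Φ) (hab : τ a ≠ τ b) :
    (radHomProj Λᵐᵒᵖ (D.P (τ a)) (D.P (τ b))).HasSection := by
  let E : (D.P (τ b) →ₗ[Λᵐᵒᵖ] D.P (τ a)) →+ (D.P (τ b) →ₗ[Λᵐᵒᵖ] D.P (τ a)) :=
    (Φ a b).symm.toAddMonoidHom.comp
      ((Q.arrowPart a b).toAddMonoidHom.comp (Φ a b).toAddMonoidHom)
  have hΦE φ : Φ a b (E φ) = Q.arrowPart a b (Φ a b φ) := (Φ a b).apply_symm_apply _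
  refine D.hasSection_of_addMonoidHom hab E (fun f φ => (Φ a b).injective ?_)
    (fun φ f => (Φ a b).injective ?_) (fun φ hφ => (Φ a b).injective ?_) (fun φ => ?_)
  · rw [hΦ, hΦE, hΦE, hΦ, Q.arrowPart_comp_left]
  · rw [hΦ, hΦE, hΦE, hΦ, Q.arrowPart_comp_right]
  · rw [hΦE, map_zero]
    exact Q.arrowPart_eq_zero (mem_decomposable_of_radHomProj_eq_zero hΛ hΦ hφ)
  · have hmem : Φ a b (φ - E φ) ∈ Q.decomposable a b := by
      rw [map_sub, hΦE]
      exact Q.sub_arrowPart_mem_decomposable (ne_of_apply_ne τ hab) _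
    simpa only [AddEquiv.symm_apply_apply] using radHomProj_toRad_symm_eq_zero hΦ hab hmem

end VertexEquiv

variable {K : Type u} [Field K] {Λ : Type v} [Ring Λ] [Algebra K Λ] [Module.Finite K Λ]
  {ι : Type w} [Finite ι] (D : SimpleSystem K Λ ι)

theorem hasSection_of_isMoritaEquivalent (hΛ : IsRightHereditary Λ) (Q : ModulatedQuiver K)
    (h : IsMoritaEquivalent K Λᵐᵒᵖ Q.TensorAlgebraᵐᵒᵖ) {i j : ι} (hij : i ≠ j) :
    (radHomProj Λᵐᵒᵖ (D.P i) (D.P j)).HasSection := by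
  obtain ⟨τ, Φ, hΦ⟩ := D.exists_vertexEquiv hΛ h
  obtain ⟨a, rfl⟩ := τ.surjective i
  obtain ⟨b, rfl⟩ := τ.surjective j
  exact hasSection_of_vertexEquiv hΛ hΦ hij

end SimpleSystem

theorem theorem5p0p1_general {K : Type u} [Field K] {Λ : Type v} [Ring Λ] [Algebra K Λ]
    [Module.Finite K Λ] (hΛ : IsRightHereditary Λ) {ι : Type w} [Fintype ι]
    (D : SimpleSystem K Λ ι) :
    List.TFAE [
      IsMoritaEquivalent K Λᵐᵒᵖ (D.modulatedQuiver hΛ).TensorAlgebraᵐᵒᵖ,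
      ∃ Q : ModulatedQuiver.{u, v, w} K, IsMoritaEquivalent K Λᵐᵒᵖ Q.TensorAlgebraᵐᵒᵖ,
      ∀ i j : ι, D.Arrow i j → (radHomProj Λᵐᵒᵖ (D.P i) (D.P j)).HasSection] := by
  tfae_have 1 → 2 := fun h => ⟨_, h⟩
  tfae_have 2 → 3 := fun ⟨Q, h⟩ _ _ hij =>
    D.hasSection_of_isMoritaEquivalent hΛ Q h (D.ne_of_arrow hΛ hij)
  tfae_have 3 → 1 := D.isMoritaEquivalent_of_hasSection hΛ
  tfae_finish

theorem theorem5p0p1 {K : Type u} [Field K] {Λ : Type v} [Ring Λ] [Algebra K Λ]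
    [Module.Finite K Λ] (hΛ : IsRightHereditary Λ) {ι : Type w} [Fintype ι]
    (D : SimpleSystem K Λ ι) :
    IsMoritaEquivalent K Λᵐᵒᵖ (D.modulatedQuiver hΛ).TensorAlgebraᵐᵒᵖ ↔
      ∀ i j : ι, D.Arrow i j → (radHomProj Λᵐᵒᵖ (D.P i) (D.P j)).HasSection :=
  (theorem5p0p1_general hΛ D).out 0 2
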